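/- Let $T$ be a polytree, i.e. a finite directed acyclic graph whose underlying undirected graph is a tree, with vertex set $V$. A path may traverse edges in either direction; a collider on a path is an interior vertex $k$ entered by both path edges at $k$ ($\cdots\to k\leftarrow\cdots$). A trek from $i$ to $j$ is a simple path from $i$ to $j$ without colliders (the empty path if $i=j$); its top $\mathrm{top}(P)$ is its unique vertex into which no edge of $P$ points, and its $i$-side (resp. $j$-side) is the part between $i$ (resp. $j$) and the top, top included. Let $\Sigma=(\sigma_{ij})$ be the symmetric $V\times V$ matrix of indeterminates, $\mathbb{C}[\Sigma]$ the polynomial ring in its entries (with $\sigma_{ij}=\sigma_{ji}$), and let $I_T$ be the kernel of the $\mathbb{C}$-algebra homomorphism $$\phi_T:\mathbb{C}[\Sigma]\to\mathbb{C}[a_i,\lambda_{kl}\mid i\in V,\ k\to l\in E(T)],\qquad \sigma_{ij}\mapsto\sum_{P \text{ trek from } i \text{ to } j} a_{\mathrm{top}(P)}\prod_{k\to l\in P}\lambda_{kl}.$$ For disjoint $A,B,C\subseteq V$, the set $C$ d-separates $A$ from $B$ if every simple path from a vertex of $A$ to a vertex of $B$ contains a non-collider belonging to $C$, or a collider that is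 not in $C$ and has no descendant in $C$. Let $C_T\subseteq\mathbb{C}[\Sigma]$ be the conditional independence ideal, generated by all $(\#C+1)$-minors of $\Sigma_{A\cup C,\,B\cup C}$ over all disjoint $A,B,C$ such that $C$ d-separates $A$ from $B$. A vertex $c$ is a choke point between $I,J\subseteq V$ if every trek from a vertex of $I$ to a vertex of $J$ contains $c$, and $c$ lies on the $I$-side of all these treks or on the $J$-side of all these treks. Then $I_T=C_T$. Moreover, $I_T$ is generated by the linear forms $\sigma_{ij}$ for the pairs $i,j$ with no trek between them, together with the tetrads $\sigma_{ij}\sigma_{kl}-\sigma_{il}\sigma_{jk}$ for those $i,j,k,l\in V$ (not necessarily distinct) such that there is a choke point between $\{i,k\}$ and $\{j,l\}$. -/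

import Mathlib

noncomputable section

/-- A directed acyclic graph: a digraph without directed cycles (in particular without loops). -/
structure DAG (V : Type*) extends Digraph V where
  acyclic : ∀ v, ¬ Relation.TransGen Adj v v

namespace DAG

variable {V : Type*}

/-- The underlying undirected graph. -/
def skeleton (G : DAG V) : SimpleGraph V := G.toDigraph.toSimpleGraphInclusive

/-- A polytree: a DAG whose underlying undirected graph is a tree. -/
def IsPolytree (G : DAG V) : Prop := G.skeleton.IsTree

/-- `w` is a (proper) descendant of `v`: there is a directed path from `v` to `w`. -/
def IsDescendant (G : DAG V) (v w : V) : Prop := Relation.TransGen G.Adj v w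

/-- `v` is a collider on the walk `p`: `p` runs `… u → v ← w …`. -/
def IsCollider (G : DAG V) {i j : V} (p : G.skeleton.Walk i j) (v : V) : Prop :=
  ∃ u w, [u, v, w] <:+: p.support ∧ G.Adj u v ∧ G.Adj w v

/-- The set `T(i,j)` of treks: simple paths from `i` to `j` in `G` (edges may be traversed in
either direction) without colliders. -/
def Trek (G : DAG V) (i j : V) : Type _ :=
  {p : G.skeleton.Walk i j // p.IsPath ∧ ∀ v, ¬ G.IsCollider p v}

/-- `t` lies on the walk `p` and no directed edge of `p` points into `t`. -/
def IsTop (G : DAG V) {i j : V} (p : G.skeleton.Walk i j) (t : V) : Prop :=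
  t ∈ p.support ∧ ∀ u, s(u, t) ∈ p.edges → ¬ G.Adj u t

/-- The directed edges of `G`. -/
abbrev Edge (G : DAG V) : Type _ := {e : V × V // G.Adj e.1 e.2}

/-- The parameter ring `ℂ[a_i, λ_ij]`; `a_i` is `X (inl i)` and `λ_ij` is `X (inr (i,j))`. -/
abbrev ParamRing (G : DAG V) : Type _ := MvPolynomial (V ⊕ G.Edge) ℂ

theorem isCollider_reverse (G : DAG V) {i j : V} (p : G.skeleton.Walk i j) (v : V)
    (h : G.IsCollider p.reverse v) : G.IsCollider p v := by
  obtain ⟨u, w, h1, h2, h3⟩ := h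
  refine ⟨w, u, ?_, h3, h2⟩
  rw [SimpleGraph.Walk.support_reverse] at h1
  simpa using List.reverse_infix.2 h1

/-- Traversing a trek backwards. -/
def Trek.reverse {G : DAG V} {i j : V} (P : G.Trek i j) : G.Trek j i :=
  ⟨P.1.reverse, P.2.1.reverse, fun v h => P.2.2 v (G.isCollider_reverse P.1 v h)⟩

theorem Trek.reverse_reverse {G : DAG V} {i j : V} (P : G.Trek i j) : P.reverse.reverse = P :=
  Subtype.ext P.1.reverse_reverse

/-- The polynomial ring `ℂ[Σ] = ℂ[σ_ij]` in the entries of a symmetric matrix: one variable for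
each unordered pair of (not necessarily distinct) vertices. -/
abbrev CovRing (V : Type*) : Type _ := MvPolynomial (Sym2 V) ℂ

/-- The variable `σ_ij = σ_ji`. -/
def σ (i j : V) : CovRing V := MvPolynomial.X s(i, j)

/-- `C` d-separates `A` from `B`: every path from `A` to `B` contains a non-collider in `C`, or a
collider that is not in `C` and has no descendant in `C`. -/
def DSeparates (G : DAG V) (C A B : Finset V) : Prop :=
  ∀ i ∈ A, ∀ j ∈ B, ∀ p : G.skeleton.Walk i j, p.IsPath →
    ∃ k ∈ p.support,
      (¬ G.IsCollider p k ∧ k ∈ C) ∨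
      (G.IsCollider p k ∧ k ∉ C ∧ ∀ d ∈ C, ¬ G.IsDescendant k d)

/-- The symmetric matrix `Σ` of indeterminates. -/
def covMatrix (V : Type*) : Matrix V V (CovRing V) := Matrix.of σ

variable [Fintype V]

theorem exists_isTop (G : DAG V) {i j : V} (p : G.skeleton.Walk i j) : ∃ t, G.IsTop p t := by
  have : Std.Irrefl (Relation.TransGen G.Adj) := ⟨G.acyclic⟩
  have wf : WellFounded (Relation.TransGen G.Adj) := Finite.wellFounded_of_trans_of_irrefl _
  obtain ⟨t, ht, hmin⟩ := wf.has_min {v | v ∈ p.support} ⟨i, p.start_mem_support⟩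
  exact ⟨t, ht, fun u hu h => hmin u (p.fst_mem_support_of_mem_edges hu) (.single h)⟩

instance finiteTrek (G : DAG V) (i j : V) : Finite (G.Trek i j) := by
  classical
  exact Finite.of_injective (β := G.skeleton.Path i j) (fun P => ⟨P.1, P.2.1⟩)
    fun P Q h => Subtype.ext (congrArg (fun R : G.skeleton.Path i j => R.1) h)

instance fintypeTrek (G : DAG V) (i j : V) : Fintype (G.Trek i j) := Fintype.ofFinite _

/-- The topmost vertex `top(P)` of a trek `P`: its only vertex into which no edge of `P` points. -/
def Trek.top {G : DAG V} {i j : V} (P : G.Trek i j) : V := (G.exists_isTop P.1).choose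

theorem Trek.top_mem {G : DAG V} {i j : V} (P : G.Trek i j) : P.top ∈ P.1.support :=
  (G.exists_isTop P.1).choose_spec.1

open scoped Classical in
/-- The monomial `a_top(P) * ∏_{k → l ∈ P} λ_kl` of a trek `P`. -/
def Trek.monomial {G : DAG V} {i j : V} (P : G.Trek i j) : G.ParamRing :=
  MvPolynomial.X (Sum.inl P.top) *
    ∏ e : G.Edge with s(e.1.1, e.1.2) ∈ P.1.edges, MvPolynomial.X (Sum.inr e)

/-- The polynomial `σ_ij(a, λ)` of the trek rule. -/
def trekPolynomial (G : DAG V) (i j : V) : G.ParamRing := ∑ P : G.Trek i j, P.monomial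

theorem Trek.monomial_reverse {G : DAG V} {i j : V} (P : G.Trek i j) :
    P.reverse.monomial = P.monomial := by
  classical
  have hT : G.IsTop P.1.reverse = G.IsTop P.1 := by
    funext t; simp [IsTop]
  have ht : P.reverse.top = P.top := by
    unfold Trek.top Trek.reverse
    congr 1
  unfold Trek.monomial
  rw [ht]
  congr 1
  refine Finset.prod_congr (Finset.ext fun e => ?_) fun _ _ => rfl
  simp only [Finset.mem_filter_univ]
  simp [Trek.reverse]

theorem trekPolynomial_comm (G : DAG V) (i j : V) :
    G.trekPolynomial i j = G.trekPolynomial j i :=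
  Fintype.sum_equiv
    ⟨Trek.reverse, Trek.reverse, Trek.reverse_reverse, Trek.reverse_reverse⟩ _ _
    fun P => P.monomial_reverse.symm

/-- The ring homomorphism `φ_G : ℂ[Σ] → ℂ[a, λ]`, `σ_ij ↦ σ_ij(a, λ)`. -/
def φ (G : DAG V) : CovRing V →ₐ[ℂ] G.ParamRing :=
  MvPolynomial.aeval (Sym2.lift ⟨G.trekPolynomial, G.trekPolynomial_comm⟩)

/-- The vanishing ideal `I_G = ker φ_G`. -/
def vanishingIdeal (G : DAG V) : Ideal (CovRing V) := RingHom.ker G.φ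

/-- The conditional independence ideal `C_G`, generated by all `(#C+1)`-minors of
`Σ_{A ∪ C, B ∪ C}` for disjoint `A`, `B`, `C` such that `C` d-separates `A` from `B`. A minor is
given by a choice of `#C+1` distinct rows and columns. -/
def ciIdeal (G : DAG V) : Ideal (CovRing V) :=
  Ideal.span {f | ∃ A B C : Finset V, Disjoint A B ∧ Disjoint A C ∧ Disjoint B C ∧
    G.DSeparates C A B ∧
    ∃ r c : Fin (C.card + 1) ↪ V, (∀ k, r k ∈ A ∨ r k ∈ C) ∧ (∀ k, c k ∈ B ∨ c k ∈ C) ∧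
      f = ((covMatrix V).submatrix r c).det}

open scoped Classical in
/-- `c` is on the `i`-side of the trek `P` from `i` to `j`: between `i` and the top, inclusive. -/
def Trek.OnLeft {G : DAG V} {i j : V} (P : G.Trek i j) (c : V) : Prop :=
  c ∈ (P.1.takeUntil P.top P.top_mem).support

open scoped Classical in
/-- `c` is on the `j`-side of the trek `P` from `i` to `j`: between the top and `j`, inclusive. -/
def Trek.OnRight {G : DAG V} {i j : V} (P : G.Trek i j) (c : V) : Prop :=
  c ∈ (P.1.dropUntil P.top P.top_mem).support

/-- `c` is a choke point between `I` and `J`: every trek from `I` to `J` contains `c`, and `c` is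
on the `I`-side of all of them or on the `J`-side of all of them. -/
def IsChokePoint (G : DAG V) (c : V) (I J : Set V) : Prop :=
  (∀ i ∈ I, ∀ j ∈ J, ∀ P : G.Trek i j, c ∈ P.1.support) ∧
  ((∀ i ∈ I, ∀ j ∈ J, ∀ P : G.Trek i j, P.OnLeft c) ∨
   (∀ i ∈ I, ∀ j ∈ J, ∀ P : G.Trek i j, P.OnRight c))

/-- The linear forms `σ_ij` for the pairs `i, j` without a trek. -/
def linearForms (G : DAG V) : Set (CovRing V) := {f | ∃ i j, IsEmpty (G.Trek i j) ∧ f = σ i j}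

/-- The tetrads `σ_ij σ_kl - σ_il σ_jk` for which there is a choke point between `{i, k}` and
`{j, l}`. -/
def tetrads (G : DAG V) : Set (CovRing V) :=
  {f | ∃ i j k l, (∃ c, G.IsChokePoint c {i, k} {j, l}) ∧ f = σ i j * σ k l - σ i l * σ j k}

end DAG

end

/-! The three ideals are compared in a cycle `I_T ⊆ ⟨linear forms, tetrads⟩ ⊆ C_T ⊆ I_T`.

A pair without a trek is d-separated by the empty set. A tetrad with choke point `c` is a minor for
the conditioning set `{c}`, unless both of its terms are multiples of linear forms.

If `C` d-separates `A` from `B`, no vertex of `C` is joined by active paths both to `A` and to `B`.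
Cutting each trek from `A ∪ C` to `B ∪ C` at a vertex of `C`, on the side of `B` if this vertex is
joined to `A` and on the side of `A` otherwise, writes the image of `Σ_{A ∪ C, B ∪ C}` as a product
of matrices with inner dimension `#C`, so its `(#C + 1)`-minors vanish.

Finally, `φ_T` maps every monomial to zero or to a monomial, so `I_T` is spanned by the monomials
containing some `σ_ij` without a trek and by the differences of monomials with the same image. The
image of a monomial `∏ σ_ij` determines, at every vertex `v`, the multiset of directions in which
the paths between `i` and `j` leave `v`. If two monomials have the same image, one of them can
therefore be rewritten by tetrads, following the path from `i` to `j` vertex by vertex, until it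
contains any given factor `σ_ij` of the other; cancelling `σ_ij` finishes the proof by induction. -/

theorem det_mul_eq_zero_of_card_lt {m ι R : Type*} [Fintype m] [DecidableEq m] [Fintype ι]
    [CommRing R] (P : Matrix m ι R) (Q : Matrix ι m R) (h : Fintype.card ι < Fintype.card m) :
    (P * Q).det = 0 := by
  obtain ⟨k, hk⟩ := Nat.exists_eq_add_of_lt h
  have e : m ≃ ι ⊕ Fin (k + 1) := Fintype.equivOfCardEq (by simpa [add_assoc] using hk)
  have hPQ : P * Q =
      ((Matrix.fromCols P 0).submatrix id e : Matrix m m R) *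
        (Matrix.fromRows Q 0).submatrix e id := by
    rw [Matrix.submatrix_mul_equiv, Matrix.fromCols_mul_fromRows, Matrix.zero_mul, add_zero,
      Matrix.submatrix_id_id]
  rw [hPQ, Matrix.det_mul, Matrix.det_eq_zero_of_column_eq_zero (e.symm (.inr 0)), zero_mul]
  simp

theorem ker_le_of_forall_basis {R M N ι κ : Type*} [CommRing R] [AddCommGroup M] [AddCommGroup N]
    [Module R M] [Module R N] (b : Module.Basis ι R M) (c : Module.Basis κ R N) (f : M →ₗ[R] N)
    (J : Submodule R M) (hf : ∀ i, f (b i) = 0 ∨ ∃ k, f (b i) = c k)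
    (h_zero : ∀ i, f (b i) = 0 → b i ∈ J)
    (h_eq : ∀ i j, f (b i) = f (b j) → f (b i) ≠ 0 → b i - b j ∈ J) :
    LinearMap.ker f ≤ J := by
  classical
  let g : N →ₗ[R] M ⧸ J :=
    c.constr R fun k => if h : ∃ i, f (b i) = c k then J.mkQ (b h.choose) else 0
  have hg : g ∘ₗ f = J.mkQ := by
    refine b.ext fun i => ?_
    rw [LinearMap.comp_apply]
    by_cases h0 : f (b i) = 0
    · rw [h0, map_zero, eq_comm, Submodule.mkQ_apply, Submodule.Quotient.mk_eq_zero]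
      exact h_zero i h0
    obtain ⟨k, hk⟩ := (hf i).resolve_left h0
    have hex : ∃ i, f (b i) = c k := ⟨i, hk⟩
    have heq : f (b hex.choose) = f (b i) := hex.choose_spec.trans hk.symm
    rw [hk, Module.Basis.constr_basis, dif_pos hex, Submodule.mkQ_apply, Submodule.mkQ_apply,
      Submodule.Quotient.eq]
    exact h_eq _ _ heq (heq ▸ h0)
  intro x hx
  rw [← J.ker_mkQ, ← hg, LinearMap.mem_ker, LinearMap.comp_apply, LinearMap.mem_ker.1 hx, map_zero]

theorem prod_map_X_eq_monomial {R α : Type*} [CommSemiring R] [DecidableEq α] (s : Multiset α) :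
    (s.map (MvPolynomial.X (R := R))).prod = MvPolynomial.monomial s.toFinsupp 1 := by
  induction s using Multiset.induction with
  | empty => simp
  | cons a s ih =>
    rw [Multiset.map_cons, Multiset.prod_cons, ih, MvPolynomial.X, MvPolynomial.monomial_mul,
      one_mul, ← Multiset.singleton_add, Multiset.toFinsupp_add, Multiset.toFinsupp_singleton]

theorem prod_map_X_injective {R α : Type*} [CommSemiring R] [Nontrivial R] :
    Function.Injective fun s : Multiset α => (s.map (MvPolynomial.X (R := R))).prod := by
  classical
  intro s t h
  simp only [prod_map_X_eq_monomial] at h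
  exact Multiset.toFinsupp.injective (MvPolynomial.monomial_left_injective one_ne_zero h)

namespace TreePath

open SimpleGraph

variable {V : Type*} {G : SimpleGraph V} (hG : G.IsTree)

/-- The unique path between two vertices of a tree. -/
noncomputable def path (i j : V) : G.Walk i j := (hG.existsUnique_path i j).choose

/-- Betweenness in a tree: `u` is a vertex of the path from `i` to `j`. -/
def OnPath (u i j : V) : Prop := u ∈ (path hG i j).support

/-- The path from `t` to `x` meets `D` at most in its end `x`. -/
def MeetsOnlyAtEnd (D : Set V) (t x : V) : Prop := ∀ d ∈ D, OnPath hG d t x → d = x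

/-- The neighbour of `u` in the direction of `i`, that is, the second vertex of the path from `u`
to `i`. By convention `step u u = u`. -/
noncomputable def step (u i : V) : V := (path hG u i).snd

theorem isPath_path (i j : V) : (path hG i j).IsPath := (hG.existsUnique_path i j).choose_spec.1

theorem eq_path {i j : V} {p : G.Walk i j} (hp : p.IsPath) : p = path hG i j :=
  (hG.existsUnique_path i j).choose_spec.2 p hp

theorem reverse_path (i j : V) : (path hG i j).reverse = path hG j i :=
  eq_path hG (isPath_path hG i j).reverse

theorem path_self (i : V) : path hG i i = .nil := (eq_path hG Walk.IsPath.nil).symm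

theorem tail_path (i j : V) : (path hG i j).tail = path hG (step hG i j) j :=
  eq_path hG (isPath_path hG i j).tail

theorem onPath_left (i j : V) : OnPath hG i i j := Walk.start_mem_support _

theorem onPath_right (i j : V) : OnPath hG j i j := Walk.end_mem_support _

theorem onPath_step (u i : V) : OnPath hG (step hG u i) u i := Walk.getVert_mem_support _ _

@[simp]
theorem onPath_self_iff {u i : V} : OnPath hG u i i ↔ u = i := by
  simp [OnPath, path_self]

@[simp]
theorem step_self (i : V) : step hG i i = i := by
  rw [step, path_self]
  rfl

theorem adj_step {u i : V} (h : u ≠ i) : G.Adj u (step hG u i) :=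
  Walk.adj_snd (Walk.not_nil_of_ne h)

@[simp]
theorem step_eq_self_iff {u i : V} : step hG u i = u ↔ u = i := by
  refine ⟨fun h => ?_, fun h => h ▸ step_self hG u⟩
  by_contra hne
  exact (adj_step hG hne).ne h.symm

theorem step_of_adj {u w : V} (h : G.Adj u w) : step hG u w = w := by
  have hp : (Walk.cons h Walk.nil).IsPath := by simpa using h.ne
  rw [step, ← eq_path hG hp]
  rfl

theorem step_step {u i : V} (h : u ≠ i) : step hG (step hG u i) u = u :=
  step_of_adj hG (adj_step hG h).symm

theorem induction_toward {P : V → Prop} (c : V) (base : P c)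
    (next : ∀ m, m ≠ c → P (step hG m c) → P m) (m : V) : P m := by
  induction hn : (path hG m c).length generalizing m with
  | zero => exact Walk.eq_of_length_eq_zero hn ▸ base
  | succ n ih =>
    obtain rfl | hm := eq_or_ne m c
    · exact base
    have htail : (path hG (step hG m c) c).length = (path hG m c).tail.length :=
      congrArg (fun p : G.Walk (step hG m c) c => p.length) (tail_path hG m c).symm
    have hlength := Walk.length_tail_add_one (Walk.not_nil_of_ne hm : ¬ (path hG m c).Nil)
    exact next m hm (ih _ (by omega))

variable {hG}

theorem onPath_comm {u i j : V} : OnPath hG u i j ↔ OnPath hG u j i := by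
  rw [OnPath, OnPath, ← reverse_path hG j i, Walk.support_reverse, List.mem_reverse]

theorem OnPath.symm {u i j : V} (h : OnPath hG u i j) : OnPath hG u j i := onPath_comm.1 h

theorem takeUntil_path [DecidableEq V] {u i j : V} (h : u ∈ (path hG i j).support) :
    (path hG i j).takeUntil u h = path hG i u :=
  eq_path hG ((isPath_path hG i j).takeUntil h)

theorem dropUntil_path [DecidableEq V] {u i j : V} (h : u ∈ (path hG i j).support) :
    (path hG i j).dropUntil u h = path hG u j :=
  eq_path hG ((isPath_path hG i j).dropUntil h)

theorem OnPath.append {u i j : V} (h : OnPath hG u i j) :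
    (path hG i u).append (path hG u j) = path hG i j := by
  classical
  have hu : u ∈ (path hG i j).support := h
  rw [← takeUntil_path hu, ← dropUntil_path hu, Walk.take_spec]

theorem OnPath.step_eq {u v j : V} (h : OnPath hG v u j) (huv : u ≠ v) :
    step hG u j = step hG u v := by
  classical
  have hv : v ∈ (path hG u j).support := h
  rw [step, step, ← takeUntil_path hv, Walk.snd_takeUntil huv.symm]

theorem onPath_of_step_ne {v i j : V} (h : step hG v i ≠ step hG v j) : OnPath hG v i j := by
  have hp : ((path hG i v).append (path hG v j)).IsPath := by
    rw [Walk.isPath_def, Walk.support_append, List.nodup_append']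
    refine ⟨(isPath_path hG i v).support_nodup, (isPath_path hG v j).support_nodup.tail, ?_⟩
    intro x hxi hxj
    have hvx : v ≠ x := by
      rintro rfl
      have hnodup := (isPath_path hG v j).support_nodup
      rw [← Walk.cons_tail_support] at hnodup
      exact (List.nodup_cons.1 hnodup).1 hxj
    have hxi : OnPath hG x v i := OnPath.symm hxi
    have hxj : OnPath hG x v j := List.mem_of_mem_tail hxj
    exact h ((hxi.step_eq hvx).trans (hxj.step_eq hvx).symm)
  rw [OnPath, ← eq_path hG hp]
  simp

theorem OnPath.step_ne {v i j : V} (h : OnPath hG v i j) (hv : v ≠ i) :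
    step hG v i ≠ step hG v j := by
  intro heq
  have hi : step hG v i ∈ (path hG i v).support := (onPath_step hG v i).symm
  have hj : step hG v i ∈ (path hG v j).support := heq ▸ onPath_step hG v j
  have hp := isPath_path hG i j
  rw [← h.append] at hp
  exact Walk.IsPath.ne_of_mem_support_of_append hp
    (fun h' => hv ((step_eq_self_iff hG).1 h')) hi hj rfl

theorem onPath_iff {v i j : V} :
    OnPath hG v i j ↔ (step hG v i = step hG v j → v = i) := by
  refine ⟨fun h heq => by_contra fun hv => h.step_ne hv heq, fun h => ?_⟩
  by_cases heq : step hG v i = step hG v j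
  · exact h heq ▸ onPath_left hG v j
  · exact onPath_of_step_ne heq

theorem not_onPath_iff {v i j : V} :
    ¬ OnPath hG v i j ↔ step hG v i = step hG v j ∧ v ≠ i := by
  rw [onPath_iff, Classical.not_imp]

theorem OnPath.left_or_right {u i j : V} (h : OnPath hG u i j) (c : V) :
    OnPath hG u i c ∨ OnPath hG u c j := by
  rw [onPath_iff] at h ⊢
  rw [onPath_iff]
  grind [step_eq_self_iff hG]

theorem OnPath.of_left {u v i l : V} (hu : OnPath hG u i v) (hv : OnPath hG v i l) :
    OnPath hG v u l := by
  obtain rfl | h := eq_or_ne v u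
  · exact onPath_left hG v l
  rw [onPath_comm, onPath_iff] at hv ⊢
  intro heq
  exact hv (heq.trans (hu.symm.step_eq h).symm)

theorem OnPath.of_right {u v i l : V} (hu : OnPath hG u v l) (hv : OnPath hG v i l) :
    OnPath hG v i u :=
  (hu.symm.of_left hv.symm).symm

theorem OnPath.trans_left {u v i l : V} (hu : OnPath hG u i v) (hv : OnPath hG v i l) :
    OnPath hG u i l := by
  rw [OnPath, ← hv.append, Walk.mem_support_append_iff]
  exact .inl hu

theorem OnPath.trans_right {u v i l : V} (hu : OnPath hG u v l) (hv : OnPath hG v i l) :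
    OnPath hG u i l :=
  (hu.symm.trans_left hv.symm).symm

theorem OnPath.antisymm {u v i : V} (hu : OnPath hG u i v) (hv : OnPath hG v i u) : u = v :=
  ((onPath_self_iff hG).1 (hu.of_left hv)).symm

variable (hG) in
theorem exists_median (a b c : V) :
    ∃ m, OnPath hG m a b ∧ OnPath hG m a c ∧ OnPath hG m b c := by
  induction c using induction_toward hG a with
  | base => exact ⟨a, onPath_left hG a b, onPath_left hG a a, onPath_right hG b a⟩
  | next c _ ih =>
    by_cases h : OnPath hG c a b
    · exact ⟨c, h, onPath_right hG a c, onPath_right hG b c⟩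
    obtain ⟨m, hab, ha, hb⟩ := ih
    refine ⟨m, hab, ha.trans_left (onPath_step hG c a).symm, hb.trans_left ?_⟩
    rw [(not_onPath_iff.1 h).1]
    exact (onPath_step hG c b).symm

variable (hG) in
theorem exists_first_mem_or_end (D : Set V) (t r : V) :
    ∃ x, OnPath hG x t r ∧ MeetsOnlyAtEnd hG D t x ∧ (x ∈ D ∨ x = r) := by
  induction r using induction_toward hG t with
  | base => exact ⟨t, onPath_left hG t t, fun d _ hd => (onPath_self_iff hG).1 hd, .inr rfl⟩
  | next r _ ih =>
    obtain ⟨x, hx, hfirst, hxD⟩ := ih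
    have hstep : OnPath hG (step hG r t) t r := (onPath_step hG r t).symm
    by_cases hxD' : x ∈ D
    · exact ⟨x, hx.trans_left hstep, hfirst, .inl hxD'⟩
    obtain rfl := hxD.resolve_left hxD'
    refine ⟨r, onPath_right hG t r, fun d hd hdr => ?_, .inr rfl⟩
    by_contra hne
    have hd' : OnPath hG d t (step hG r t) := by
      rw [hdr.symm.step_eq (Ne.symm hne)]
      exact ((onPath_step hG r d).of_left hdr.symm).symm
    exact hxD' (hfirst d hd hd' ▸ hd)

theorem MeetsOnlyAtEnd.eq {D : Set V} {t r x y : V} (hx : MeetsOnlyAtEnd hG D t x)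
    (hy : MeetsOnlyAtEnd hG D t y) (hxD : x ∈ D) (hyD : y ∈ D) (hxr : OnPath hG x t r)
    (hyr : OnPath hG y t r) : x = y := by
  rcases hxr.left_or_right y with h | h
  · exact hy x hxD h
  · exact (hx y hyD (h.of_right hyr)).symm

theorem mem_edges_path_iff {v w i j : V} :
    s(v, w) ∈ (path hG i j).edges ↔
      OnPath hG v i j ∧ w ≠ v ∧ (w = step hG v i ∨ w = step hG v j) := by
  have snd_mem : ∀ k, step hG v k ≠ v → s(v, step hG v k) ∈ (path hG v k).edges := fun k hk =>
    Walk.mk_start_snd_mem_edges (Walk.not_nil_of_ne fun h => hk ((step_eq_self_iff hG).2 h))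
  have mem_edges_append (hv : OnPath hG v i j) : s(v, w) ∈ (path hG i j).edges ↔
      s(v, w) ∈ (path hG v i).edges ∨ s(v, w) ∈ (path hG v j).edges := by
    rw [← hv.append, Walk.edges_append, List.mem_append, ← reverse_path hG v i,
      Walk.edges_reverse, List.mem_reverse]
  constructor
  · intro h
    have hv : OnPath hG v i j := Walk.fst_mem_support_of_mem_edges _ h
    refine ⟨hv, (Walk.adj_of_mem_edges _ h).ne.symm, ?_⟩
    exact ((mem_edges_append hv).1 h).imp (isPath_path hG v i).eq_snd_of_mem_edges
      (isPath_path hG v j).eq_snd_of_mem_edges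
  · rintro ⟨hv, hne, rfl | rfl⟩
    · exact (mem_edges_append hv).2 (.inl (snd_mem i hne))
    · exact (mem_edges_append hv).2 (.inr (snd_mem j hne))

variable (hG) in
theorem support_path_of_ne {i j : V} (h : i ≠ j) :
    (path hG i j).support = i :: (path hG (step hG i j) j).support := by
  rw [← Walk.cons_support_tail (Walk.not_nil_of_ne h)]
  exact congrArg (fun p : G.Walk (step hG i j) j => i :: p.support) (tail_path hG i j)

theorem OnPath.infix_support {v i j : V} (hv : OnPath hG v i j) (hi : v ≠ i) (hj : v ≠ j) :
    [step hG v i, v, step hG v j] <:+: (path hG i j).support := by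
  rw [← hv.append, Walk.support_append, ← reverse_path hG v i, Walk.support_reverse,
    support_path_of_ne hG hi, support_path_of_ne hG hj, ← Walk.cons_tail_support (path hG _ i),
    ← Walk.cons_tail_support (path hG _ j)]
  exact ⟨(path hG (step hG v i) i).support.tail.reverse,
    (path hG (step hG v j) j).support.tail, by
      simp only [List.reverse_cons, List.append_assoc, List.cons_append, List.nil_append,
        List.tail_cons]⟩

theorem eq_step_of_infix_support {u v w i j : V}
    (h : [u, v, w] <:+: (path hG i j).support) :
    OnPath hG v i j ∧
      (u = step hG v i ∧ w = step hG v j ∨ u = step hG v j ∧ w = step hG v i) := by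
  have huv : s(v, u) ∈ (path hG i j).edges := Sym2.eq_swap ▸
    Walk.infix_support_iff_mem_edges.1 (.inl (List.IsInfix.trans ⟨[], [w], by simp⟩ h))
  have hvw : s(v, w) ∈ (path hG i j).edges :=
    Walk.infix_support_iff_mem_edges.1 (.inl (List.IsInfix.trans ⟨[u], [], by simp⟩ h))
  have hne : u ≠ w := by
    have hnodup := h.sublist.nodup (isPath_path hG i j).support_nodup
    grind
  rw [mem_edges_path_iff] at huv hvw
  grind

open scoped Classical in
variable (hG) in
/-- The two directions in which the path between the given vertices leaves `v`, if it passes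
through `v`. A path that ends at `v` has `v` itself as a direction there. -/
noncomputable def directions (v : V) : Sym2 V → Multiset V :=
  Sym2.lift ⟨fun i j => if OnPath hG v i j then {step hG v i, step hG v j} else 0, fun i j => by
    simp only [onPath_comm (i := i), Multiset.pair_comm (step hG v i)]⟩

theorem OnPath.directions_eq {v i j : V} (h : OnPath hG v i j) :
    directions hG v s(i, j) = {step hG v i, step hG v j} := by
  rw [directions, Sym2.lift_mk, Subtype.coe_mk, if_pos h]

theorem directions_eq_zero {v i j : V} (h : ¬ OnPath hG v i j) :
    directions hG v s(i, j) = 0 := by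
  rw [directions, Sym2.lift_mk, Subtype.coe_mk, if_neg h]

end TreePath

namespace DAG

open TreePath

variable {V : Type*} {T : DAG V} {hG : T.skeleton.IsTree}

section Treks

theorem not_adj_self (v : V) : ¬ T.Adj v v := fun h => T.acyclic v (.single h)

theorem not_adj_of_adj {u v : V} (h : T.Adj u v) : ¬ T.Adj v u := fun h' =>
  T.acyclic v (.tail (.single h') h)

theorem skeleton_adj_iff {u v : V} : T.skeleton.Adj u v ↔ T.Adj u v ∨ T.Adj v u := by
  simp only [skeleton, Digraph.toSimpleGraphInclusive, SimpleGraph.fromRel_adj,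
    and_iff_right_iff_imp]
  rintro h rfl
  exact T.not_adj_self u (or_self_iff.1 h)

variable (hG)

/-- The path between `i` and `j` in the tree underlying a polytree has no collider, so that it is
the trek between `i` and `j`. -/
def Linked (i j : V) : Prop :=
  ∀ u, OnPath hG u i j → ¬ (T.Adj (step hG u i) u ∧ T.Adj (step hG u j) u)

/-- The path from `t` to `i` in the tree underlying a polytree is directed: `i` is `t` or a
descendant of `t`. -/
def Descends (t i : V) : Prop := ∀ u, OnPath hG u t i → ¬ T.Adj (step hG u i) u

/-- `t` is the top of the trek between `i` and `j`. -/
def IsTopOf (t i j : V) : Prop := OnPath hG t i j ∧ Descends hG t i ∧ Descends hG t j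

theorem not_adj_step_self (u : V) : ¬ T.Adj (step hG u u) u := by
  rw [step_self]
  exact T.not_adj_self u

variable {hG}

theorem ne_of_adj_step {u i : V} (h : T.Adj (step hG u i) u) : u ≠ i := by
  rintro rfl
  exact not_adj_step_self hG u h

theorem adj_step_of_not_adj {u i : V} (h : ¬ T.Adj (step hG u i) u) (hne : u ≠ i) :
    T.Adj u (step hG u i) :=
  (skeleton_adj_iff.1 (adj_step hG hne)).resolve_right h

theorem step_adj_of_not_adj {u i : V} (h : ¬ T.Adj u (step hG u i)) (hne : u ≠ i) :
    T.Adj (step hG u i) u :=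
  (skeleton_adj_iff.1 (adj_step hG hne)).resolve_left h

/-! ### Directed paths -/

variable (hG) in
theorem descends_refl (t : V) : Descends hG t t := by
  intro u hu
  rw [(onPath_self_iff hG).1 hu]
  exact not_adj_step_self hG t

theorem Descends.right {t i u : V} (h : Descends hG t i) (hu : OnPath hG u t i) :
    Descends hG u i :=
  fun v hv => h v (hv.trans_right hu)

theorem Descends.left {t i u : V} (h : Descends hG t i) (hu : OnPath hG u t i) :
    Descends hG t u := by
  intro v hv
  obtain rfl | hne := eq_or_ne v u
  · exact not_adj_step_self hG v
  · rw [← (hv.of_left hu).step_eq hne]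
    exact h v (hv.trans_left hu)

theorem Descends.step_adj {t i : V} (h : Descends hG t i) (hne : i ≠ t) :
    T.Adj (step hG i t) i := by
  refine step_adj_of_not_adj (fun hadj => ?_) hne
  have hstep := h _ (onPath_step hG i t).symm
  rw [step_step hG hne] at hstep
  exact hstep hadj

theorem Descends.onPath {t m i : V} (h : Descends hG t m) (h' : Descends hG m i) :
    OnPath hG m t i := by
  rw [onPath_iff]
  intro heq
  by_contra hne
  exact h' m (onPath_left hG m i) (heq ▸ h.step_adj hne)

theorem Descends.trans {t m i : V} (h : Descends hG t m) (h' : Descends hG m i) :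
    Descends hG t i := by
  intro u hu
  rcases hu.left_or_right m with hum | hum
  · obtain rfl | hne := eq_or_ne u m
    · exact h' u (onPath_left hG u i)
    · rw [(hum.of_left (h.onPath h')).step_eq hne]
      exact h u hum
  · exact h' u hum

theorem Descends.antisymm {t i : V} (h : Descends hG t i) (h' : Descends hG i t) : t = i := by
  by_contra hne
  exact h' i (onPath_left hG i t) (h.step_adj (Ne.symm hne))

variable (hG) in
theorem step_of_parent {p m : V} (h : T.Adj p m) : step hG m p = p :=
  step_of_adj hG (skeleton_adj_iff.2 (.inr h))

variable (hG) in
theorem step_of_child {p m : V} (h : T.Adj p m) : step hG p m = m :=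
  step_of_adj hG (skeleton_adj_iff.2 (.inl h))

variable (hG) in
theorem descends_of_adj {p m : V} (h : T.Adj p m) : Descends hG p m := by
  intro u hu
  obtain rfl | hum := eq_or_ne u m
  · exact not_adj_step_self hG u
  suffices u = p by
    rw [this, step_of_child hG h]
    exact not_adj_of_adj h
  by_contra hup
  refine hum (OnPath.antisymm hu ?_)
  nth_rw 1 [← step_of_child hG h, hu.step_eq (Ne.symm hup)]
  exact onPath_step hG p u

theorem Descends.eq_step_of_adj {t p m : V} (h : Descends hG t p) (hp : T.Adj p m) :
    p = step hG m t := by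
  have hm := descends_of_adj hG hp
  rw [(h.onPath hm).symm.step_eq, step_of_parent hG hp]
  rintro rfl
  exact T.not_adj_self m hp

/-! ### Treks -/

theorem Linked.symm {i j : V} (h : Linked hG i j) : Linked hG j i :=
  fun u hu hc => h u hu.symm hc.symm

theorem Linked.left {u i j : V} (h : Linked hG i j) (hu : OnPath hG u i j) : Linked hG i u := by
  rintro v hv ⟨hvi, hvu⟩
  refine h v (hv.trans_left hu) ⟨hvi, ?_⟩
  rwa [(hv.of_left hu).step_eq (ne_of_adj_step hvu)]

theorem Descends.linked {t i j : V} (hi : Descends hG t i) (hj : Descends hG t j) :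
    Linked hG i j := by
  rintro u hu ⟨hui, huj⟩
  rcases hu.left_or_right t with h | h
  · exact hi u h.symm hui
  · exact hj u h huj

theorem Linked.descends {c i j : V} (h : Linked hG i j) (hc : OnPath hG c i j)
    (hci : ¬ T.Adj (step hG c i) c) : Descends hG c i := by
  have hic := h.left hc
  intro u
  induction u using induction_toward hG c with
  | base => exact fun _ => hci
  | next u hne ih =>
    intro hu hadj
    have hpu := (onPath_step hG u c).symm
    have hp := ih (hpu.trans_left hu)
    rw [(hpu.of_left hu).step_eq ((step_eq_self_iff hG).not.2 hne), step_step hG hne] at hp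
    exact hic u hu.symm ⟨hadj, step_adj_of_not_adj hp hne⟩

theorem Linked.of_descends {c i l : V} (h : Linked hG c l) (hi : Descends hG c i) :
    Linked hG i l := by
  rintro u hu ⟨hui, hul⟩
  by_cases huc : OnPath hG u c i
  · exact hi u huc hui
  · have hcl : OnPath hG u c l := (hu.left_or_right c).resolve_left fun h => huc h.symm
    rw [← (not_onPath_iff.1 huc).1] at hui
    exact h u hcl ⟨hui, hul⟩

theorem IsTopOf.symm {t i j : V} (h : IsTopOf hG t i j) : IsTopOf hG t j i :=
  ⟨h.1.symm, h.2.symm⟩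

theorem IsTopOf.eq {t t' i j : V} (h : IsTopOf hG t i j) (h' : IsTopOf hG t' i j) : t = t' := by
  have eq_of_onPath : ∀ {i j}, IsTopOf hG t i j → IsTopOf hG t' i j → OnPath hG t i t' → t = t' :=
    fun h h' ht => (h.2.2.left (ht.of_left h'.1)).antisymm (h'.2.1.left ht.symm)
  rcases h.1.left_or_right t' with ht | ht
  · exact eq_of_onPath h h' ht
  · exact eq_of_onPath h.symm h'.symm ht.symm

theorem IsTopOf.onPath {m t i j : V} (h : IsTopOf hG m i j) (hi : Descends hG t i)
    (hj : Descends hG t j) : OnPath hG m t i := by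
  obtain ⟨n, hij, hit, hjt⟩ := exists_median hG i j t
  rw [h.eq ⟨hij, hi.right hit.symm, hj.right hjt.symm⟩]
  exact hit.symm

theorem isCollider_path_iff {v i j : V} : T.IsCollider (path hG i j) v ↔
    OnPath hG v i j ∧ T.Adj (step hG v i) v ∧ T.Adj (step hG v j) v := by
  constructor
  · rintro ⟨u, w, h, hu, hw⟩
    obtain ⟨hv, ⟨rfl, rfl⟩ | ⟨rfl, rfl⟩⟩ := eq_step_of_infix_support h
    · exact ⟨hv, hu, hw⟩
    · exact ⟨hv, hw, hu⟩
  · rintro ⟨hv, hi, hj⟩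
    exact ⟨_, _, hv.infix_support (ne_of_adj_step hi) (ne_of_adj_step hj), hi, hj⟩

variable (hG) in
theorem Trek.val_eq_path {i j : V} (P : T.Trek i j) : P.1 = path hG i j := eq_path hG P.2.1

variable (hG) in
theorem nonempty_trek_iff {i j : V} : Nonempty (T.Trek i j) ↔ Linked hG i j := by
  constructor
  · rintro ⟨P⟩ u hu hc
    have hP := P.2.2 u
    rw [P.val_eq_path hG, isCollider_path_iff] at hP
    exact hP ⟨hu, hc⟩
  · exact fun h => ⟨⟨path hG i j, isPath_path hG i j, fun v hv =>
      h v (isCollider_path_iff.1 hv).1 (isCollider_path_iff.1 hv).2⟩⟩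

variable (hG) in
theorem Trek.linked {i j : V} (P : T.Trek i j) : Linked hG i j := (nonempty_trek_iff hG).1 ⟨P⟩

theorem Linked.isTopOf_of_isTop {t i j : V} (h : Linked hG i j) (ht : T.IsTop (path hG i j) t) :
    IsTopOf hG t i j := by
  have not_adj : ∀ k, k = i ∨ k = j → ¬ T.Adj (step hG t k) t := by
    intro k hk hadj
    refine ht.2 _ ?_ hadj
    rw [Sym2.eq_swap, mem_edges_path_iff, Ne, step_eq_self_iff]
    refine ⟨ht.1, ne_of_adj_step hadj, ?_⟩
    rcases hk with rfl | rfl <;> simp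
  exact ⟨ht.1, h.descends ht.1 (not_adj i (.inl rfl)),
    h.symm.descends (OnPath.symm ht.1) (not_adj j (.inr rfl))⟩

theorem Linked.exists_isTopOf {i j : V} (h : Linked hG i j) : ∃ t, IsTopOf hG t i j := by
  induction i using induction_toward hG j with
  | base => exact ⟨j, onPath_left hG j j, descends_refl hG j, descends_refl hG j⟩
  | next i _ ih =>
    by_cases hadj : T.Adj (step hG i j) i
    · have hstep := onPath_step hG i j
      obtain ⟨t, ht, hti, htj⟩ := ih (h.symm.left hstep.symm).symm
      exact ⟨t, ht.trans_right hstep, hti.trans (descends_of_adj hG hadj), htj⟩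
    · exact ⟨i, onPath_left hG i j, descends_refl hG i,
        h.symm.descends (onPath_right hG j i) hadj⟩

variable [Fintype V]

variable (hG) in
theorem Trek.isTopOf_top {i j : V} (P : T.Trek i j) : IsTopOf hG P.top i j := by
  have htop : T.IsTop P.1 P.top := (T.exists_isTop P.1).choose_spec
  rw [P.val_eq_path hG] at htop
  exact (P.linked hG).isTopOf_of_isTop htop

variable (hG) in
theorem Trek.onLeft_iff {i j : V} (P : T.Trek i j) {c : V} :
    P.OnLeft c ↔ OnPath hG c i j ∧ Descends hG c i := by
  classical
  have ht := P.isTopOf_top hG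
  have hP : P.OnLeft c ↔ OnPath hG c i P.top := by
    rw [Trek.OnLeft, eq_path hG (P.2.1.takeUntil P.top_mem)]
    rfl
  rw [hP]
  refine ⟨fun hc => ⟨hc.trans_left ht.1, ht.2.1.right hc.symm⟩, fun ⟨hc, hci⟩ => ?_⟩
  refine (hc.left_or_right P.top).elim id fun htc => ?_
  have hct : Descends hG c P.top := hci.left (htc.of_right ht.1).symm
  rw [hct.antisymm (ht.2.2.left htc)]
  exact onPath_right hG i P.top

variable (hG) in
theorem Trek.onRight_iff {i j : V} (P : T.Trek i j) {c : V} :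
    P.OnRight c ↔ OnPath hG c i j ∧ Descends hG c j := by
  classical
  have htop : P.reverse.top = P.top := (P.reverse.isTopOf_top hG).symm.eq (P.isTopOf_top hG)
  have hP : P.OnRight c ↔ P.reverse.OnLeft c := by
    rw [Trek.OnRight, Trek.OnLeft, eq_path hG (P.2.1.dropUntil P.top_mem),
      eq_path hG (P.reverse.2.1.takeUntil P.reverse.top_mem), htop]
    exact onPath_comm
  rw [hP, P.reverse.onLeft_iff hG, onPath_comm]

variable (hG) in
/-- `c` is a choke point between `I` and `J` on the `I`-side: every trek from `I` to `J` passes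
through `c` and descends from `c` to its end in `I`. -/
def IsLeftChoke (c : V) (I J : Set V) : Prop :=
  ∀ i ∈ I, ∀ j ∈ J, Linked hG i j → OnPath hG c i j ∧ Descends hG c i

variable (hG) in
theorem isChokePoint_iff {c : V} {I J : Set V} :
    T.IsChokePoint c I J ↔ IsLeftChoke hG c I J ∨ IsLeftChoke hG c J I := by
  simp only [IsChokePoint, Trek.onLeft_iff hG, Trek.onRight_iff hG, Trek.val_eq_path hG]
  constructor
  · rintro ⟨-, h | h⟩
    · refine .inl fun i hi j hj hij => ?_
      obtain ⟨P⟩ := (nonempty_trek_iff hG).2 hij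
      exact h i hi j hj P
    · refine .inr fun j hj i hi hji => ?_
      obtain ⟨P⟩ := (nonempty_trek_iff hG).2 hji.symm
      exact (h i hi j hj P).imp_left OnPath.symm
  · rintro (h | h)
    · exact ⟨fun i hi j hj P => (h i hi j hj (P.linked hG)).1,
        .inl fun i hi j hj P => h i hi j hj (P.linked hG)⟩
    · exact ⟨fun i hi j hj P => (h j hj i hi (P.linked hG).symm).1.symm,
        .inr fun i hi j hj P => (h j hj i hi (P.linked hG).symm).imp_left OnPath.symm⟩

/-! ### The trek rule on a polytree -/

theorem σ_comm {V : Type*} (i j : V) : σ i j = σ j i := by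
  rw [σ, σ, Sym2.eq_swap]

open scoped Classical in
variable (hG) in
/-- The product of the edge parameters along the path between `i` and `j`. -/
noncomputable def weight (i j : V) : T.ParamRing :=
  ∏ e : T.Edge with s(e.1.1, e.1.2) ∈ (path hG i j).edges, MvPolynomial.X (Sum.inr e)

theorem weight_comm (i j : V) : weight hG i j = weight hG j i := by
  classical
  refine Finset.prod_congr (Finset.filter_congr fun e _ => ?_) fun _ _ => rfl
  rw [← reverse_path hG i j, SimpleGraph.Walk.edges_reverse, List.mem_reverse]

@[simp]
theorem weight_self (i : V) : weight hG i i = 1 := by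
  simp [weight, path_self]

theorem weight_mul_weight {c i j : V} (h : OnPath hG c i j) :
    weight hG i c * weight hG c j = weight hG i j := by
  classical
  have hnodup := (isPath_path hG i j).isTrail.edges_nodup
  rw [← h.append, SimpleGraph.Walk.edges_append, List.nodup_append'] at hnodup
  rw [weight, weight, weight, ← Finset.prod_union]
  · simp only [← Finset.filter_or, ← List.mem_append, ← SimpleGraph.Walk.edges_append, h.append]
  · rw [Finset.disjoint_filter]
    exact fun e _ hic hcj => hnodup.2.2 hic hcj

theorem trekPolynomial_eq_zero {i j : V} (h : ¬ Linked hG i j) : T.trekPolynomial i j = 0 := by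
  rw [← nonempty_trek_iff, not_nonempty_iff] at h
  exact Fintype.sum_empty _

theorem IsTopOf.trekPolynomial_eq {i j t : V} (ht : IsTopOf hG t i j) :
    T.trekPolynomial i j = MvPolynomial.X (Sum.inl t) * weight hG i j := by
  obtain ⟨P⟩ := (nonempty_trek_iff hG).2 (ht.2.1.linked ht.2.2)
  have : Subsingleton (T.Trek i j) :=
    ⟨fun P Q => Subtype.ext ((P.val_eq_path hG).trans (Q.val_eq_path hG).symm)⟩
  rw [trekPolynomial, Fintype.sum_subsingleton _ P, Trek.monomial, ht.eq (P.isTopOf_top hG),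
    P.val_eq_path hG, weight]

theorem φ_σ (i j : V) : T.φ (σ i j) = T.trekPolynomial i j := by
  rw [φ, σ, MvPolynomial.aeval_X, Sym2.lift_mk]

end Treks

/-! ### The covariance matrix in terms of error variances -/

section ErrorVariance

variable [Fintype V]

open scoped Classical in
variable (hG) in
/-- The product of the edge parameters along the directed path from `t` to `i`, and zero if there
is no such path. -/
noncomputable def dirWeight (t i : V) : T.ParamRing :=
  if Descends hG t i then weight hG t i else 0

open scoped Classical in
variable (hG) in
/-- The variance of the error term of the vertex `t` in the linear structural equation model with
edge coefficients `λ`. In the model the parameter `a_t` is the variance of the variable at `t`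
itself. -/
noncomputable def errorVariance (t : V) : T.ParamRing :=
  MvPolynomial.X (Sum.inl t) - ∑ p with T.Adj p t, weight hG p t ^ 2 * MvPolynomial.X (Sum.inl p)

theorem Descends.dirWeight_eq {t i : V} (h : Descends hG t i) :
    dirWeight hG t i = weight hG t i := if_pos h

theorem dirWeight_eq_zero {t i : V} (h : ¬ Descends hG t i) : dirWeight hG t i = 0 := if_neg h

theorem Descends.dirWeight_mul_dirWeight {t m i : V} (h : Descends hG t m)
    (h' : Descends hG m i) : dirWeight hG t m * dirWeight hG m i = dirWeight hG t i := by
  rw [h.dirWeight_eq, h'.dirWeight_eq, (h.trans h').dirWeight_eq, weight_mul_weight (h.onPath h')]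

variable (hG) in
theorem dirWeight_self (t : V) : dirWeight hG t t = 1 := by
  rw [(descends_refl hG t).dirWeight_eq, weight_self]

variable (hG) in
theorem dirWeight_of_adj {p m : V} (h : T.Adj p m) : dirWeight hG p m = weight hG p m :=
  (descends_of_adj hG h).dirWeight_eq

open scoped Classical in
theorem dirWeight_sq_of_ne {t m : V} (h : m ≠ t) :
    dirWeight hG t m ^ 2 = ∑ p with T.Adj p m, weight hG p m ^ 2 * dirWeight hG t p ^ 2 := by
  by_cases htm : Descends hG t m
  · have hparent := htm.step_adj h
    have hstep := htm.left (onPath_step hG m t).symm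
    rw [Finset.sum_eq_single_of_mem (step hG m t) (by simpa using hparent),
      ← hstep.dirWeight_mul_dirWeight (descends_of_adj hG hparent), dirWeight_of_adj hG hparent]
    · ring
    · intro p hp hne
      rw [Finset.mem_filter_univ] at hp
      rw [dirWeight_eq_zero fun htp => hne (htp.eq_step_of_adj hp)]
      ring
  · rw [dirWeight_eq_zero htm, Finset.sum_eq_zero, zero_pow two_ne_zero]
    intro p hp
    rw [Finset.mem_filter_univ] at hp
    rw [dirWeight_eq_zero fun htp => htm (htp.trans (descends_of_adj hG hp))]
    ring

theorem sum_parents_weight_sq_mul_dirWeight_sq_self [DecidableRel T.Adj] (m : V) :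
    ∑ p with T.Adj p m, weight hG p m ^ 2 * dirWeight hG m p ^ 2 = 0 := by
  refine Finset.sum_eq_zero fun p hp => ?_
  rw [Finset.mem_filter_univ] at hp
  rw [dirWeight_eq_zero fun hmp => T.not_adj_self m ?_]
  · ring
  · rwa [← hmp.antisymm (descends_of_adj hG hp)] at hp

variable (hG) in
theorem X_eq_sum_errorVariance (m : V) : (MvPolynomial.X (Sum.inl m) : T.ParamRing) =
    ∑ t, errorVariance hG t * dirWeight hG t m ^ 2 := by
  classical
  have : Std.Irrefl (Relation.TransGen T.Adj) := ⟨T.acyclic⟩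
  have wf : WellFounded (Relation.TransGen T.Adj) := Finite.wellFounded_of_trans_of_irrefl _
  induction m using wf.induction with
  | h m ih =>
    have dirWeight_sq (t : V) : dirWeight hG t m ^ 2 = (if t = m then 1 else 0) +
        ∑ p with T.Adj p m, weight hG p m ^ 2 * dirWeight hG t p ^ 2 := by
      obtain rfl | h := eq_or_ne m t
      · rw [sum_parents_weight_sq_mul_dirWeight_sq_self, dirWeight_self, if_pos rfl]
        ring
      · rw [dirWeight_sq_of_ne h, if_neg h.symm, zero_add]
    have sum_parent : ∀ p ∈ Finset.univ.filter (T.Adj · m),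
        ∑ t, errorVariance hG t * (weight hG p m ^ 2 * dirWeight hG t p ^ 2) =
        weight hG p m ^ 2 * MvPolynomial.X (Sum.inl p) := by
      intro p hp
      rw [Finset.mem_filter_univ] at hp
      rw [ih p (.single hp), Finset.mul_sum]
      exact Finset.sum_congr rfl fun t _ => by ring
    simp_rw [dirWeight_sq, mul_add, Finset.sum_add_distrib, Finset.mul_sum]
    rw [Finset.sum_comm, Finset.sum_congr rfl sum_parent]
    simp [errorVariance]

theorem IsTopOf.dirWeight_mul_dirWeight {m i j : V} (h : IsTopOf hG m i j) (t : V) :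
    dirWeight hG t i * dirWeight hG t j = dirWeight hG t m ^ 2 * weight hG i j := by
  by_cases htm : Descends hG t m
  · rw [← htm.dirWeight_mul_dirWeight h.2.1, ← htm.dirWeight_mul_dirWeight h.2.2,
      ← weight_mul_weight h.1, h.2.1.dirWeight_eq, h.2.2.dirWeight_eq, weight_comm i m]
    ring
  · have not_both : ¬ Descends hG t i ∨ ¬ Descends hG t j :=
      not_and_or.1 fun ⟨hi, hj⟩ => htm (hi.left (h.onPath hi hj))
    rcases not_both with hi | hj
    · simp [dirWeight_eq_zero htm, dirWeight_eq_zero hi]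
    · simp [dirWeight_eq_zero htm, dirWeight_eq_zero hj]

variable (hG) in
theorem trekPolynomial_eq_sum_errorVariance (i j : V) :
    T.trekPolynomial i j = ∑ t, errorVariance hG t * (dirWeight hG t i * dirWeight hG t j) := by
  by_cases h : Linked hG i j
  · obtain ⟨m, hm⟩ := h.exists_isTopOf
    rw [hm.trekPolynomial_eq, X_eq_sum_errorVariance hG m, Finset.sum_mul]
    simp_rw [hm.dirWeight_mul_dirWeight, mul_assoc]
  · rw [trekPolynomial_eq_zero h, Finset.sum_eq_zero]
    intro t _
    by_cases hi : Descends hG t i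
    · rw [dirWeight_eq_zero fun hj => h (hi.linked hj), mul_zero, mul_zero]
    · rw [dirWeight_eq_zero hi, zero_mul, mul_zero]

end ErrorVariance

/-! ### Splitting directed paths at their first vertex in a set -/

section FirstHit

variable [Fintype V]

open scoped Classical in
variable (hG) in
/-- The weight of the directed path from `t` to `i` if it avoids `D`, and zero otherwise. -/
noncomputable def avoidWeight (D : Set V) (t i : V) : T.ParamRing :=
  if ∀ d ∈ D, ¬ OnPath hG d t i then dirWeight hG t i else 0

open scoped Classical in
variable (hG) in
/-- The weight of the directed path from `t` to `c` if it meets `D` at most in `c`, and zero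
otherwise. -/
noncomputable def hitWeight (D : Set V) (t c : V) : T.ParamRing :=
  if MeetsOnlyAtEnd hG D t c then dirWeight hG t c else 0

open scoped Classical in
theorem dirWeight_mul_dirWeight_eq_ite (t c i : V) :
    dirWeight hG t c * dirWeight hG c i =
      if OnPath hG c t i then dirWeight hG t i else 0 := by
  by_cases h : Descends hG t c ∧ Descends hG c i
  · rw [if_pos (h.1.onPath h.2), h.1.dirWeight_mul_dirWeight h.2]
  · have hzero : dirWeight hG t c * dirWeight hG c i = 0 := by
      rcases not_and_or.1 h with h | h <;> simp [dirWeight_eq_zero h]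
    rw [hzero]
    split_ifs with hc
    · rw [dirWeight_eq_zero fun hti => h ⟨hti.left hc, hti.right hc⟩]
    · rfl

theorem dirWeight_eq_avoidWeight_add_sum (D : Finset V) (t i : V) :
    dirWeight hG t i =
      avoidWeight hG D t i + ∑ c ∈ D, hitWeight hG D t c * dirWeight hG c i := by
  classical
  have term_eq (c : V) : hitWeight hG D t c * dirWeight hG c i =
      if MeetsOnlyAtEnd hG D t c ∧ OnPath hG c t i then dirWeight hG t i else 0 := by
    rw [hitWeight, ite_mul, zero_mul, dirWeight_mul_dirWeight_eq_ite, ite_and]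
  simp_rw [term_eq]
  obtain ⟨x, hxi, hx, hxD⟩ := exists_first_mem_or_end hG D t i
  by_cases hmem : x ∈ D
  · rw [avoidWeight, if_neg fun h => h x hmem hxi, zero_add,
      Finset.sum_eq_single_of_mem x hmem fun c hc hne =>
        if_neg fun h => hne (h.1.eq hx hc hmem h.2 hxi), if_pos ⟨hx, hxi⟩]
  · obtain rfl := hxD.resolve_left hmem
    have avoids : ∀ d ∈ (D : Set V), ¬ OnPath hG d t x := fun d hd h => hmem (hx d hd h ▸ hd)
    rw [avoidWeight, if_pos avoids,
      Finset.sum_eq_zero fun c hc => if_neg fun h => avoids c hc h.2, add_zero]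

theorem avoidWeight_mul_avoidWeight_eq_zero {D E : Set V} {t r s : V}
    (h : Descends hG t r → Descends hG t s →
      (∃ c ∈ D, OnPath hG c t r) ∨ ∃ c ∈ E, OnPath hG c t s) :
    avoidWeight hG D t r * avoidWeight hG E t s = 0 := by
  rw [avoidWeight, avoidWeight]
  split_ifs with hD hE <;> try simp only [mul_zero, zero_mul]
  by_cases hr : Descends hG t r
  · have hs : ¬ Descends hG t s := fun hs =>
      (h hr hs).elim (fun ⟨c, hc, hct⟩ => hD c hc hct) fun ⟨c, hc, hct⟩ => hE c hc hct
    rw [dirWeight_eq_zero hs, mul_zero]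
  · rw [dirWeight_eq_zero hr, zero_mul]

theorem trekPolynomial_eq_sum_add_sum {D E : Finset V} {r s : V}
    (h : ∀ t, Descends hG t r → Descends hG t s →
      (∃ c ∈ D, OnPath hG c t r) ∨ ∃ c ∈ E, OnPath hG c t s) :
    T.trekPolynomial r s =
      ∑ c ∈ D, dirWeight hG c r *
        ∑ t, errorVariance hG t * hitWeight hG D t c * dirWeight hG t s +
      ∑ c ∈ E, (∑ t, errorVariance hG t * avoidWeight hG D t r * hitWeight hG E t c) *
        dirWeight hG c s := by
  have mul_eq (t : V) : dirWeight hG t r * dirWeight hG t s =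
      (∑ c ∈ D, hitWeight hG D t c * dirWeight hG c r) * dirWeight hG t s +
      avoidWeight hG D t r * ∑ c ∈ E, hitWeight hG E t c * dirWeight hG c s := by
    have hr := dirWeight_eq_avoidWeight_add_sum (hG := hG) D t r
    have hs := dirWeight_eq_avoidWeight_add_sum (hG := hG) E t s
    have hzero := avoidWeight_mul_avoidWeight_eq_zero (hG := hG) (D := D) (E := E) (h t)
    linear_combination dirWeight hG t s * hr + avoidWeight hG D t r * hs + hzero
  simp only [trekPolynomial_eq_sum_errorVariance hG, mul_eq, mul_add, Finset.sum_add_distrib,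
    Finset.sum_mul, Finset.mul_sum]
  rw [Finset.sum_comm, Finset.sum_comm (t := E)]
  refine congrArg₂ (· + ·) ?_ ?_ <;>
    refine Finset.sum_congr rfl fun c _ => Finset.sum_congr rfl fun t _ => ?_ <;> ring

end FirstHit

/-! ### Active paths -/

section ActivePaths

variable (hG) in
/-- The vertex `u` does not block the path between `x` and `y` given `C`. At an end of the path
lying in `C` this says that the path points into that end, because `step u u = u`. -/
def OpenAt (C : Set V) (u x y : V) : Prop :=
  (u ∈ C → ¬ T.Adj u (step hG u x) ∧ ¬ T.Adj u (step hG u y)) ∧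
  (T.Adj (step hG u x) u → T.Adj (step hG u y) u → ∃ d ∈ C, Relation.ReflTransGen T.Adj u d)

variable (hG) in
/-- The path between `x` and `y` is active given `C`. Unlike in the usual notion, its ends may lie
in `C`, as long as the path points into them; then active paths can be composed in `C`. -/
def Active (C : Set V) (x y : V) : Prop := ∀ u, OnPath hG u x y → OpenAt hG C u x y

variable {C : Set V}

theorem OpenAt.symm {u x y : V} (h : OpenAt hG C u x y) : OpenAt hG C u y x :=
  ⟨fun hu => (h.1 hu).symm, fun hy hx => h.2 hx hy⟩

theorem Active.symm {x y : V} (h : Active hG C x y) : Active hG C y x :=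
  fun u hu => (h u hu.symm).symm

/-- Following the path towards `c` downwards, one meets a collider or ends in `c`. -/
theorem Active.exists_reflTransGen {a c m : V} (h : Active hG C a c) (hc : c ∈ C)
    (hm : OnPath hG m a c) (hdown : ¬ T.Adj (step hG m c) m) :
    ∃ d ∈ C, Relation.ReflTransGen T.Adj m d := by
  induction m using induction_toward hG c with
  | base => exact ⟨c, hc, .refl⟩
  | next m hne ih =>
    have hadj : T.Adj m (step hG m c) := adj_step_of_not_adj hdown hne
    have hstep : OnPath hG (step hG m c) a c := (onPath_step hG m c).trans_right hm
    have hback : step hG (step hG m c) a = m := by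
      have hmid : OnPath hG m a (step hG m c) := (onPath_step hG m c).of_right hm
      rw [hmid.symm.step_eq (adj_step hG hne).ne', step_of_parent hG hadj]
    obtain ⟨d, hd, hpath⟩ : ∃ d ∈ C, Relation.ReflTransGen T.Adj (step hG m c) d := by
      by_cases hup : T.Adj (step hG (step hG m c) c) (step hG m c)
      · exact (h _ hstep).2 (hback.symm ▸ hadj) hup
      · exact ih hstep hup
    exact ⟨d, hd, .head hadj hpath⟩

theorem Active.openAt_median {a y c m : V} (ha : Active hG C a c) (hy : Active hG C y c)
    (hc : c ∈ C) (hac : OnPath hG m a c) (hyc : OnPath hG m y c) : OpenAt hG C m a y := by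
  refine ⟨fun hm => ⟨((ha m hac).1 hm).1, ((hy m hyc).1 hm).1⟩, fun hma _ => ?_⟩
  by_cases hmc : T.Adj (step hG m c) m
  · exact (ha m hac).2 hma hmc
  · exact ha.exists_reflTransGen hc hac hmc

theorem Active.trans {a y c : V} (ha : Active hG C a c) (hy : Active hG C y c) (hc : c ∈ C) :
    Active hG C a y := by
  obtain ⟨m, hay, hac, hyc⟩ := exists_median hG a y c
  have open_of_left : ∀ {a y}, Active hG C a c → Active hG C y c → OnPath hG m a y →
      OnPath hG m a c → OnPath hG m y c → ∀ u, OnPath hG u a m → OpenAt hG C u a y := by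
    intro a y ha hy hay hac hyc u hu
    obtain rfl | hum := eq_or_ne u m
    · exact ha.openAt_median hy hc hac hyc
    · have hopen := ha u (hu.trans_left hac)
      rwa [OpenAt, (hu.of_left hac).step_eq hum, ← (hu.of_left hay).step_eq hum] at hopen
  intro u hu
  rcases hu.left_or_right m with h | h
  · exact open_of_left ha hy hay hac hyc u h
  · exact (open_of_left hy ha hay.symm hyc hac u h.symm).symm

theorem Descends.openAt {t x y u : V} (hx : Descends hG t x) (hxC : MeetsOnlyAtEnd hG C t x)
    (hyC : MeetsOnlyAtEnd hG C t y) (hu : OnPath hG u t x) : OpenAt hG C u x y := by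
  refine ⟨fun huC => ?_, fun hux => absurd hux (hx u hu)⟩
  obtain rfl := hxC u huC hu
  have not_adj : ¬ T.Adj u (step hG u u) := by
    rw [step_self]
    exact T.not_adj_self u
  refine ⟨not_adj, ?_⟩
  by_cases hut : OnPath hG u t y
  · obtain rfl := hyC u huC hut
    exact not_adj
  · obtain ⟨hstep, hne⟩ := not_onPath_iff.1 hut
    rw [← hstep]
    exact not_adj_of_adj (hx.step_adj hne)

theorem Descends.active {t x y : V} (hx : Descends hG t x) (hy : Descends hG t y)
    (hxC : MeetsOnlyAtEnd hG C t x) (hyC : MeetsOnlyAtEnd hG C t y) : Active hG C x y := by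
  intro u hu
  rcases hu.left_or_right t with h | h
  · exact hx.openAt hxC hyC h.symm
  · exact (hy.openAt hyC hxC h).symm

theorem DSeparates.not_active {A B C : Finset V} (h : T.DSeparates C A B) (hAC : Disjoint A C)
    (hBC : Disjoint B C) {a b : V} (ha : a ∈ A) (hb : b ∈ B) : ¬ Active hG C a b := by
  intro hactive
  obtain ⟨k, hk, hblock⟩ := h a ha b hb _ (isPath_path hG a b)
  obtain ⟨h_noncollider, h_collider⟩ := hactive k hk
  rw [isCollider_path_iff] at hblock
  rcases hblock with ⟨hcol, hkC⟩ | ⟨⟨-, hka, hkb⟩, hkC, hdesc⟩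
  · obtain ⟨hka, hkb⟩ := h_noncollider hkC
    refine hcol ⟨hk, step_adj_of_not_adj hka ?_, step_adj_of_not_adj hkb ?_⟩
    · exact fun heq => Finset.disjoint_left.1 hAC ha (heq ▸ hkC)
    · exact fun heq => Finset.disjoint_left.1 hBC hb (heq ▸ hkC)
  · obtain ⟨d, hd, hkd⟩ := h_collider hka hkb
    rcases Relation.reflTransGen_iff_eq_or_transGen.1 hkd with rfl | hkd
    · exact hkC hd
    · exact hdesc d hd hkd

/-! ### Conditional independence constraints vanish on the model -/

theorem DSeparates.exists_mem_onPath {A B C : Finset V} (h : T.DSeparates C A B)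
    (hAC : Disjoint A C) (hBC : Disjoint B C) {r s t : V} (hr : r ∈ A ∨ r ∈ C)
    (hs : s ∈ B ∨ s ∈ C) (htr : Descends hG t r) (hts : Descends hG t s) :
    (∃ c ∈ C, (¬ ∃ a ∈ A, Active hG C a c) ∧ OnPath hG c t r) ∨
      ∃ c ∈ C, (∃ a ∈ A, Active hG C a c) ∧ OnPath hG c t s := by
  obtain ⟨x, hx, hxC, hxr⟩ := exists_first_mem_or_end hG C t r
  obtain ⟨y, hy, hyC, hys⟩ := exists_first_mem_or_end hG C t s
  have hxy : Active hG C x y := (htr.left hx).active (hts.left hy) hxC hyC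
  rw [Finset.mem_coe] at hxr hys
  have hxAC : x ∈ C ∨ x ∈ A := hxr.elim .inl fun heq => heq ▸ hr.symm
  have hyBC : y ∈ C ∨ y ∈ B := hys.elim .inl fun heq => heq ▸ hs.symm
  by_contra! hcon
  have hAy : ∃ a ∈ A, Active hG C a y := by
    rcases hxAC with hxC | hxA
    · obtain ⟨a, ha, hax⟩ : ∃ a ∈ A, Active hG C a x := by
        by_contra! hA
        exact hcon.1 x hxC hA hx
      exact ⟨a, ha, hax.trans hxy.symm hxC⟩
    · exact ⟨x, hxA, hxy⟩
  rcases hyBC with hyC | hyB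
  · exact hcon.2 y hyC hAy hy
  · obtain ⟨a, ha, hay⟩ := hAy
    exact h.not_active hAC hBC ha hyB hay

variable [Fintype V]

theorem DSeparates.exists_factorization (hG : T.skeleton.IsTree) {A B C : Finset V}
    (h : T.DSeparates C A B) (hAC : Disjoint A C) (hBC : Disjoint B C) :
    ∃ P Q : V → V → T.ParamRing, ∀ r s, r ∈ A ∨ r ∈ C → s ∈ B ∨ s ∈ C →
      T.trekPolynomial r s = ∑ c ∈ C, P r c * Q c s := by
  classical
  set D := C.filter fun c => ¬ ∃ a ∈ A, Active hG C a c with hD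
  set E := C.filter fun c => ∃ a ∈ A, Active hG C a c with hE
  refine ⟨fun r c => if ∃ a ∈ A, Active hG C a c
      then ∑ t, errorVariance hG t * avoidWeight hG D t r * hitWeight hG E t c
      else dirWeight hG c r,
    fun c s => if ∃ a ∈ A, Active hG C a c then dirWeight hG c s
      else ∑ t, errorVariance hG t * hitWeight hG D t c * dirWeight hG t s,
    fun r s hr hs => ?_⟩
  have hsep (t : V) (htr : Descends hG t r) (hts : Descends hG t s) :
      (∃ c ∈ D, OnPath hG c t r) ∨ ∃ c ∈ E, OnPath hG c t s := by
    simp only [hD, hE, Finset.mem_filter, and_assoc]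
    exact h.exists_mem_onPath hAC hBC hr hs htr hts
  rw [trekPolynomial_eq_sum_add_sum hsep, add_comm, hD, hE, Finset.sum_filter, Finset.sum_filter,
    ← Finset.sum_add_distrib]
  refine Finset.sum_congr rfl fun c _ => ?_
  beta_reduce
  by_cases hc : ∃ a ∈ A, Active hG C a c
  · rw [if_pos hc, if_pos hc, if_pos hc, if_neg (not_not.2 hc), add_zero]
  · rw [if_neg hc, if_neg hc, if_neg hc, if_pos hc, zero_add]

theorem ciIdeal_le_vanishingIdeal (hG : T.skeleton.IsTree) : T.ciIdeal ≤ T.vanishingIdeal := by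
  rw [ciIdeal, Ideal.span_le]
  rintro _ ⟨A, B, C, -, hAC, hBC, hsep, r, c, hr, hc, rfl⟩
  obtain ⟨P, Q, hPQ⟩ := hsep.exists_factorization hG hAC hBC
  have hfactor : T.φ.mapMatrix ((covMatrix V).submatrix r c) =
      (Matrix.of fun a (d : C) => P (r a) d) * Matrix.of fun (d : C) b => Q d (c b) := by
    ext1 a b
    rw [Matrix.mul_apply, Finset.univ_eq_attach]
    exact (φ_σ _ _).trans ((hPQ _ _ (hr a) (hc b)).trans (Finset.sum_attach C _).symm)
  refine RingHom.mem_ker.2 ?_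
  rw [AlgHom.map_det, hfactor]
  exact det_mul_eq_zero_of_card_lt _ _ (by simp)

end ActivePaths

/-! ### Linear forms and tetrads are conditional independence constraints -/

section Constraints

theorem det_submatrix_mem_ciIdeal {A B C : Finset V} (hAB : Disjoint A B) (hAC : Disjoint A C)
    (hBC : Disjoint B C) (hsep : T.DSeparates C A B) {n : ℕ} (hn : C.card + 1 = n)
    (r c : Fin n ↪ V) (hr : ∀ k, r k ∈ A ∨ r k ∈ C) (hc : ∀ k, c k ∈ B ∨ c k ∈ C) :
    ((covMatrix V).submatrix r c).det ∈ T.ciIdeal := by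
  subst hn
  exact Ideal.subset_span ⟨A, B, C, hAB, hAC, hBC, hsep, r, c, hr, hc, rfl⟩

theorem dSeparates_empty_of_not_linked {i j : V} (h : ¬ Linked hG i j) :
    T.DSeparates ∅ {i} {j} := by
  intro a ha b hb p hp
  rw [Finset.mem_singleton] at ha hb
  subst ha hb
  obtain ⟨u, hu, hcol⟩ : ∃ u, OnPath hG u a b ∧
      (T.Adj (step hG u a) u ∧ T.Adj (step hG u b) u) := by
    simpa only [Linked, not_forall, not_not, exists_prop] using h
  rw [eq_path hG hp]
  exact ⟨u, hu, .inr ⟨isCollider_path_iff.2 ⟨hu, hcol⟩, Finset.notMem_empty u, by simp⟩⟩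

theorem dSeparates_singleton_of_linked {A B : Finset V} {c : V}
    (h : ∀ a ∈ A, ∀ b ∈ B, Linked hG a b ∧ OnPath hG c a b) : T.DSeparates {c} A B := by
  intro a ha b hb p hp
  obtain ⟨hab, hc⟩ := h a ha b hb
  rw [eq_path hG hp]
  exact ⟨c, hc, .inl ⟨fun hcol => hab c hc (isCollider_path_iff.1 hcol).2,
    Finset.mem_singleton_self c⟩⟩

theorem σ_mem_ciIdeal {i j : V} (h : ¬ Linked hG i j) : σ i j ∈ T.ciIdeal := by
  have hne : i ≠ j := by
    rintro rfl
    exact h ((descends_refl hG i).linked (descends_refl hG i))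
  have hdet := det_submatrix_mem_ciIdeal (Finset.disjoint_singleton.2 hne)
    (Finset.disjoint_empty_right _) (Finset.disjoint_empty_right _)
    (dSeparates_empty_of_not_linked h) (n := 1) rfl ⟨![i], Function.injective_of_subsingleton _⟩
    ⟨![j], Function.injective_of_subsingleton _⟩ (fun _ => .inl (by simp)) (fun _ => .inl (by simp))
  rwa [Matrix.det_unique] at hdet

theorem σ_mul_σ_mem_ciIdeal {i j k l : V} (h : ¬ (Linked hG i j ∧ Linked hG k l)) :
    σ i j * σ k l ∈ T.ciIdeal := by
  rcases not_and_or.1 h with h | h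
  · exact Ideal.mul_mem_right _ _ (σ_mem_ciIdeal h)
  · exact Ideal.mul_mem_left _ _ (σ_mem_ciIdeal h)

theorem tetrad_mem_ciIdeal {c i j k l : V}
    (h : ∀ a ∈ ({i, k} : Set V), ∀ b ∈ ({j, l} : Set V), Linked hG a b ∧ OnPath hG c a b) :
    σ i j * σ k l - σ i l * σ j k ∈ T.ciIdeal := by
  classical
  obtain rfl | hik := eq_or_ne i k
  · rw [σ_comm j i, mul_comm, sub_self]
    exact Ideal.zero_mem _
  obtain rfl | hjl := eq_or_ne j l
  · rw [σ_comm j k, sub_self]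
    exact Ideal.zero_mem _
  have pair_mem (a b : V) (x : Fin 2) : (![a, b] : Fin 2 → V) x ∈ ({a, b} : Finset V).erase c ∨
      (![a, b] : Fin 2 → V) x ∈ ({c} : Finset V) := by
    rw [Finset.mem_singleton, or_iff_not_imp_right, Finset.mem_erase]
    exact fun hne => ⟨hne, by fin_cases x <;> simp⟩
  have hdisj : Disjoint (({i, k} : Finset V).erase c) (({j, l} : Finset V).erase c) := by
    rw [Finset.disjoint_left]
    intro x hx hx'
    rw [Finset.mem_erase] at hx hx'
    have hc := (h x (by simpa using hx.2) x (by simpa using hx'.2)).2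
    exact hx.1 ((onPath_self_iff hG).1 hc).symm
  have hsep : T.DSeparates {c} (({i, k} : Finset V).erase c) (({j, l} : Finset V).erase c) :=
    dSeparates_singleton_of_linked fun a ha b hb => h a (by simpa using Finset.mem_of_mem_erase ha)
      b (by simpa using Finset.mem_of_mem_erase hb)
  have hdet := det_submatrix_mem_ciIdeal hdisj
    (Finset.disjoint_singleton_right.2 (Finset.notMem_erase c _))
    (Finset.disjoint_singleton_right.2 (Finset.notMem_erase c _)) hsep (n := 2) rfl
    ⟨![i, k], injective_pair_iff_ne.2 hik⟩ ⟨![j, l], injective_pair_iff_ne.2 hjl⟩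
    (pair_mem i k) (pair_mem j l)
  rw [Matrix.det_fin_two] at hdet
  rw [σ_comm j k]
  exact hdet

theorem IsLeftChoke.linked {c i j k l : V} {I J : Set V} (h : IsLeftChoke hG c I J) (hi : i ∈ I)
    (hk : k ∈ I) (hj : j ∈ J) (hl : l ∈ J) (hij : Linked hG i j) (hkl : Linked hG k l) :
    Linked hG i l :=
  (hkl.symm.left (h k hk l hl hkl).1.symm).symm.of_descends (h i hi j hj hij).2

theorem IsLeftChoke.tetrad_mem_ciIdeal {c i j k l : V} (h : IsLeftChoke hG c {i, k} {j, l}) :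
    σ i j * σ k l - σ i l * σ j k ∈ T.ciIdeal := by
  have hi : i ∈ ({i, k} : Set V) := .inl rfl
  have hk : k ∈ ({i, k} : Set V) := .inr rfl
  have hj : j ∈ ({j, l} : Set V) := .inl rfl
  have hl : l ∈ ({j, l} : Set V) := .inr rfl
  by_cases hlinked : Linked hG i j ∧ Linked hG k l
  · obtain ⟨hij, hkl⟩ := hlinked
    have hil := h.linked hi hk hj hl hij hkl
    have hkj := h.linked hk hi hl hj hkl hij
    refine DAG.tetrad_mem_ciIdeal (hG := hG) (c := c) fun a ha b hb => ?_
    have hab : Linked hG a b := by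
      rcases ha with rfl | rfl <;> rcases hb with rfl | rfl <;> assumption
    exact ⟨hab, (h a ha b hb hab).1⟩
  · have hlinked' : ¬ (Linked hG i l ∧ Linked hG k j) := fun ⟨hil, hkj⟩ =>
      hlinked ⟨h.linked hi hk hl hj hil hkj, h.linked hk hi hj hl hkj hil⟩
    rw [σ_comm j k]
    exact Ideal.sub_mem _ (σ_mul_σ_mem_ciIdeal hlinked) (σ_mul_σ_mem_ciIdeal hlinked')

variable [Fintype V]

theorem span_le_ciIdeal (hG : T.skeleton.IsTree) :
    Ideal.span (T.linearForms ∪ T.tetrads) ≤ T.ciIdeal := by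
  rw [Ideal.span_le]
  rintro _ (⟨i, j, h, rfl⟩ | ⟨i, j, k, l, ⟨c, hc⟩, rfl⟩)
  · rw [← not_nonempty_iff, nonempty_trek_iff hG] at h
    exact σ_mem_ciIdeal h
  · rcases (isChokePoint_iff hG).1 hc with h | h
    · exact h.tetrad_mem_ciIdeal
    · rw [σ_comm i j, σ_comm k l, mul_comm (σ i l)]
      exact h.tetrad_mem_ciIdeal

end Constraints

/-! ### The directions in which treks leave a vertex -/

open scoped Classical in
/-- A specialization of the parameters under which a trek monomial becomes the product of `x y` over
the directions `y` in which the trek leaves `v`. The powers of `x v` are chosen such that they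
cancel unless the trek ends at `v`. -/
noncomputable def directionEval {K : Type*} [Field K] [Algebra ℂ K] (T : DAG V) (v : V)
    (x : V → K) : T.ParamRing →ₐ[ℂ] K :=
  MvPolynomial.aeval (Sum.elim (fun t => if t = v then x v ^ 2 else 1) fun e =>
    if e.1.2 = v then x e.1.1 * x v else if e.1.1 = v then x e.1.2 * (x v)⁻¹ else 1)

section directionEval

variable {K : Type*} [Field K] [Algebra ℂ K] {x : V → K} {v : V}

open scoped Classical in
theorem directionEval_X_inl (t : V) :
    directionEval T v x (MvPolynomial.X (Sum.inl t)) = if t = v then x v ^ 2 else 1 := by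
  rw [directionEval, MvPolynomial.aeval_X, Sum.elim_inl]

theorem directionEval_X_parent {u : V} (h : T.Adj u v) :
    directionEval T v x (MvPolynomial.X (Sum.inr ⟨(u, v), h⟩)) = x u * x v := by
  rw [directionEval, MvPolynomial.aeval_X, Sum.elim_inr, if_pos rfl]

theorem directionEval_X_child {w : V} (h : T.Adj v w) :
    directionEval T v x (MvPolynomial.X (Sum.inr ⟨(v, w), h⟩)) = x w * (x v)⁻¹ := by
  have hne : w ≠ v := by
    rintro rfl
    exact T.not_adj_self _ h
  rw [directionEval, MvPolynomial.aeval_X, Sum.elim_inr, if_neg hne, if_pos rfl]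

theorem directionEval_X_of_ne {e : T.Edge} (h₁ : e.1.1 ≠ v) (h₂ : e.1.2 ≠ v) :
    directionEval T v x (MvPolynomial.X (Sum.inr e)) = 1 := by
  rw [directionEval, MvPolynomial.aeval_X, Sum.elim_inr, if_neg h₂, if_neg h₁]

variable [Fintype V]

theorem directionEval_weight_of_not_onPath {i j : V} (h : ¬ OnPath hG v i j) :
    directionEval T v x (weight hG i j) = 1 := by
  classical
  rw [weight, map_prod]
  refine Finset.prod_eq_one fun e he => ?_
  rw [Finset.mem_filter_univ] at he
  refine directionEval_X_of_ne ?_ ?_ <;> rintro rfl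
  · exact h (mem_edges_path_iff.1 he).1
  · exact h (mem_edges_path_iff.1 (Sym2.eq_swap ▸ he)).1

/-- The edge at `v` of the path to a vertex other than `v` is the only one whose parameter is not
specialized to one. -/
theorem directionEval_weight_of_edge {j : V} {a b : V} (h : T.Adj a b)
    (hab : s(a, b) = s(v, step hG v j)) (hne : v ≠ j) :
    directionEval T v x (weight hG v j) =
      directionEval T v x (MvPolynomial.X (Sum.inr ⟨(a, b), h⟩)) := by
  classical
  have step_ne : step hG v j ≠ v := (step_eq_self_iff hG).not.2 hne
  have edge_eq {w : V} (hw : s(v, w) ∈ (path hG v j).edges) : s(v, w) = s(v, step hG v j) := by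
    obtain ⟨-, hwv, rfl | rfl⟩ := mem_edges_path_iff.1 hw
    · exact absurd (step_self hG v) hwv
    · rfl
  rw [weight, map_prod, Finset.prod_eq_single ⟨(a, b), h⟩]
  · intro e he hne_e
    rw [Finset.mem_filter_univ] at he
    have eq_of_edge_eq (h' : s(e.1.1, e.1.2) = s(v, step hG v j)) : e = ⟨(a, b), h⟩ := by
      rcases Sym2.eq_iff.1 (h'.trans hab.symm) with ⟨ha, hb⟩ | ⟨hb, ha⟩
      · exact Subtype.ext (Prod.ext ha hb)
      · exact absurd e.2 (not_adj_of_adj (hb ▸ ha ▸ h))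
    refine directionEval_X_of_ne (fun hv => hne_e (eq_of_edge_eq ?_))
      fun hv => hne_e (eq_of_edge_eq ?_)
    · rw [hv] at he ⊢
      exact edge_eq he
    · rw [hv, Sym2.eq_swap] at he ⊢
      exact edge_eq he
  · intro hab'
    rw [Finset.mem_filter_univ, hab, mem_edges_path_iff] at hab'
    exact absurd ⟨onPath_left hG v j, step_ne, .inr rfl⟩ hab'

open scoped Classical in
theorem directionEval_weight (hx : x v ≠ 0) (j : V) : directionEval T v x (weight hG v j) =
    x (step hG v j) * if T.Adj (step hG v j) v then x v else (x v)⁻¹ := by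
  obtain rfl | hne := eq_or_ne v j
  · rw [weight_self, map_one, if_neg (not_adj_step_self hG v), step_self, mul_inv_cancel₀ hx]
  by_cases h : T.Adj (step hG v j) v
  · rw [directionEval_weight_of_edge h Sym2.eq_swap hne, directionEval_X_parent, if_pos h]
  · rw [directionEval_weight_of_edge (adj_step_of_not_adj h hne) rfl hne,
      directionEval_X_child, if_neg h]

theorem Linked.directionEval_trekPolynomial {i j : V} (h : Linked hG i j) (hx : x v ≠ 0) :
    directionEval T v x (T.trekPolynomial i j) =
      ((directions hG v s(i, j)).map x).prod := by
  classical
  obtain ⟨t, ht⟩ := h.exists_isTopOf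
  rw [ht.trekPolynomial_eq, map_mul, directionEval_X_inl]
  by_cases hv : OnPath hG v i j
  · have htop : t = v ↔ ¬ T.Adj (step hG v i) v ∧ ¬ T.Adj (step hG v j) v := by
      refine ⟨?_, fun hadj => ht.eq ⟨hv, h.descends hv hadj.1, h.symm.descends hv.symm hadj.2⟩⟩
      rintro rfl
      exact ⟨ht.2.1 t (onPath_left hG t i), ht.2.2 t (onPath_left hG t j)⟩
    rw [hv.directions_eq, ← weight_mul_weight hv, weight_comm i v, map_mul,
      directionEval_weight hx, directionEval_weight hx, Multiset.insert_eq_cons, Multiset.map_cons,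
      Multiset.prod_cons, Multiset.map_singleton, Multiset.prod_singleton]
    have hcol := h v hv
    by_cases hi : T.Adj (step hG v i) v <;> by_cases hj : T.Adj (step hG v j) v
    · exact absurd ⟨hi, hj⟩ hcol
    all_goals
      simp only [htop, hi, hj, not_true_eq_false, not_false_eq_true, and_true, and_false, if_true,
        if_false]
      field_simp
  · have htv : t ≠ v := by
      rintro rfl
      exact hv ht.1
    rw [if_neg htv, directions_eq_zero hv, directionEval_weight_of_not_onPath hv, one_mul,
      Multiset.map_zero, Multiset.prod_zero]

end directionEval

section Joinable

/-- The monomial in the entries of the covariance matrix with the given factors `σ_ij`. -/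
noncomputable def covMonomial (M : Multiset (Sym2 V)) : CovRing V := (M.map MvPolynomial.X).prod

theorem covMonomial_cons (i j : V) (M : Multiset (Sym2 V)) :
    covMonomial (s(i, j) ::ₘ M) = σ i j * covMonomial M := by
  rw [covMonomial, covMonomial, Multiset.map_cons, Multiset.prod_cons, σ]

theorem exists_cons_of_mem_bind_directions {N : Multiset (Sym2 V)} {v y : V}
    (hy : y ∈ N.bind (directions hG v)) :
    ∃ k z N', N = s(k, z) ::ₘ N' ∧ OnPath hG v k z ∧ step hG v k = y := by
  obtain ⟨s, hs, hys⟩ := Multiset.mem_bind.1 hy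
  obtain ⟨N', rfl⟩ := Multiset.exists_cons_of_mem hs
  induction s with | h k z =>
  by_cases hkz : OnPath hG v k z
  · rw [hkz.directions_eq, Multiset.insert_eq_cons, Multiset.mem_cons,
      Multiset.mem_singleton] at hys
    rcases hys with rfl | rfl
    · exact ⟨k, z, N', rfl, hkz, rfl⟩
    · exact ⟨z, k, N', by rw [Sym2.eq_swap], hkz.symm, rfl⟩
  · rw [directions_eq_zero hkz] at hys
    exact absurd hys (Multiset.notMem_zero y)

/-! ### Joining trek halves at a vertex -/

open scoped Classical in
/-- The port of `v` used by trek halves that leave `v` in the direction of `y`. All parents of `v`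
share the port `none`, since halves through two parents would collide at `v`. -/
noncomputable def port (T : DAG V) (v y : V) : Option V := if T.Adj y v then none else some y

variable (hG) in
/-- The paths from `v` to `i` and to `j` form a path without collider at `v`. -/
def Joinable (v i j : V) : Prop :=
  OnPath hG v i j ∧ ¬ (T.Adj (step hG v i) v ∧ T.Adj (step hG v j) v)

theorem Linked.joinable {v i j : V} (h : Linked hG i j) (hv : OnPath hG v i j) :
    Joinable hG v i j :=
  ⟨hv, h v hv⟩

theorem Joinable.symm {v i j : V} (h : Joinable hG v i j) : Joinable hG v j i :=
  ⟨h.1.symm, fun hadj => h.2 hadj.symm⟩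

theorem joinable_iff {v i j : V} : Joinable hG v i j ↔
    (T.port v (step hG v i) = T.port v (step hG v j) → T.port v (step hG v i) = some v) := by
  rw [Joinable, onPath_iff, ← step_eq_self_iff hG (u := v) (i := i)]
  unfold port
  grind [T.not_adj_self v]

theorem joinable_of_port_ne {v i j : V}
    (h : T.port v (step hG v i) ≠ T.port v (step hG v j)) : Joinable hG v i j :=
  joinable_iff.2 fun heq => absurd heq h

theorem Joinable.congr_right {v i j k : V} (h : Joinable hG v i j)
    (hk : step hG v k = step hG v j) : Joinable hG v i k := by
  rw [joinable_iff] at h ⊢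
  rwa [hk]

theorem Joinable.joinable_or {v i c d : V} (h : Joinable hG v c d) :
    Joinable hG v i c ∨ Joinable hG v i d := by
  simp only [joinable_iff] at h ⊢
  grind

open scoped Classical in
theorem Joinable.two_mul_countP_port_le {v c d : V} (h : Joinable hG v c d) {p : Option V}
    (hp : p ≠ some v) : 2 * (directions hG v s(c, d)).countP (T.port v · = p) ≤
      (directions hG v s(c, d)).card := by
  rw [h.1.directions_eq, Multiset.card_pair, Multiset.insert_eq_cons, Multiset.countP_cons,
    ← Multiset.cons_zero, Multiset.countP_cons, Multiset.countP_zero]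
  rw [joinable_iff] at h
  split_ifs with hd hc
  · exact absurd (hc ▸ h (hc.trans hd.symm)) hp
  all_goals omega

open scoped Classical in
theorem card_le_two_mul_countP_port {v : V} {N : Multiset (Sym2 V)} {p : Option V}
    (h : ∀ c d, s(c, d) ∈ N → OnPath hG v c d →
      T.port v (step hG v c) ≠ p → T.port v (step hG v d) = p) :
    (N.bind (directions hG v)).card ≤ 2 * (N.bind (directions hG v)).countP (T.port v · = p) := by
  induction N using Multiset.induction with
  | empty => simp
  | cons s N ih =>
    have hN := ih fun c d hcd => h c d (Multiset.mem_cons_of_mem hcd)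
    induction s with | h c d =>
    have hs : (directions hG v s(c, d)).card ≤
        2 * (directions hG v s(c, d)).countP (T.port v · = p) := by
      by_cases hcd : OnPath hG v c d
      · have hport := h c d (Multiset.mem_cons_self _ _) hcd
        rw [hcd.directions_eq, Multiset.card_pair, Multiset.insert_eq_cons, Multiset.countP_cons,
          ← Multiset.cons_zero, Multiset.countP_cons, Multiset.countP_zero]
        split_ifs with hd hc hc
        all_goals first | omega | exact absurd (hport hc) hd
      · simp [directions_eq_zero hcd]
    rw [Multiset.cons_bind, Multiset.card_add, Multiset.countP_add]
    omega

variable [Fintype V]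

/-! ### Invariants of monomials with the same image -/

theorem linked_of_mem {M : Multiset (Sym2 V)} {i j : V} (hM : T.φ (covMonomial M) ≠ 0)
    (hij : s(i, j) ∈ M) : Linked hG i j := by
  by_contra h
  obtain ⟨M', rfl⟩ := Multiset.exists_cons_of_mem hij
  rw [covMonomial_cons, map_mul, φ_σ, trekPolynomial_eq_zero h, zero_mul] at hM
  exact hM rfl

theorem directionEval_φ_covMonomial {K : Type*} [Field K] [Algebra ℂ K] {x : V → K} {v : V}
    (hx : x v ≠ 0) {M : Multiset (Sym2 V)} (hM : T.φ (covMonomial M) ≠ 0) :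
    directionEval T v x (T.φ (covMonomial M)) =
      ((M.bind (directions hG v)).map x).prod := by
  induction M using Multiset.induction with
  | empty => simp [covMonomial]
  | cons s M ih =>
    induction s with | h i j =>
    have hij : Linked hG i j := linked_of_mem hM (Multiset.mem_cons_self _ _)
    rw [covMonomial_cons, map_mul] at hM ⊢
    rw [map_mul, ih (right_ne_zero_of_mul hM), φ_σ, hij.directionEval_trekPolynomial hx,
      Multiset.cons_bind, Multiset.map_add, Multiset.prod_add]

variable (hG) in
theorem bind_directions_eq {M N : Multiset (Sym2 V)} (hM : T.φ (covMonomial M) ≠ 0)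
    (h : T.φ (covMonomial M) = T.φ (covMonomial N)) (v : V) :
    M.bind (directions hG v) = N.bind (directions hG v) := by
  have algebraMap_injective := IsFractionRing.injective (MvPolynomial V ℂ)
    (FractionRing (MvPolynomial V ℂ))
  let x (y : V) : FractionRing (MvPolynomial V ℂ) :=
    algebraMap (MvPolynomial V ℂ) _ (MvPolynomial.X y)
  have hx : x v ≠ 0 := (map_ne_zero_iff _ algebraMap_injective).2 (MvPolynomial.X_ne_zero v)
  have prod_map_x (s : Multiset V) :
      (s.map x).prod = algebraMap (MvPolynomial V ℂ) (FractionRing (MvPolynomial V ℂ))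
        (s.map MvPolynomial.X).prod := by
    rw [map_multiset_prod, Multiset.map_map]
    rfl
  have heval := congrArg (directionEval T v x) h
  rw [directionEval_φ_covMonomial (hG := hG) hx hM,
    directionEval_φ_covMonomial (hG := hG) hx (h ▸ hM), prod_map_x, prod_map_x] at heval
  exact prod_map_X_injective (algebraMap_injective heval)

open scoped Classical in
theorem two_mul_countP_port_le {v : V} {M : Multiset (Sym2 V)} (hM : T.φ (covMonomial M) ≠ 0)
    {p : Option V} (hp : p ≠ some v) :
    2 * (M.bind (directions hG v)).countP (T.port v · = p) ≤ (M.bind (directions hG v)).card := by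
  induction M using Multiset.induction with
  | empty => simp
  | cons s M ih =>
    induction s with | h i j =>
    have hij : Linked hG i j := linked_of_mem hM (Multiset.mem_cons_self _ _)
    rw [covMonomial_cons, map_mul] at hM
    have hM' := ih (right_ne_zero_of_mul hM)
    have hs : 2 * (directions hG v s(i, j)).countP (T.port v · = p) ≤
        (directions hG v s(i, j)).card := by
      by_cases hv : OnPath hG v i j
      · exact (hij.joinable hv).two_mul_countP_port_le hp
      · simp [directions_eq_zero hv]
    rw [Multiset.cons_bind, Multiset.card_add, Multiset.countP_add]
    omega

/-- If `M` has two more halves at `v` than `N`, both at the port `p`, then `N` has a trek avoiding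
that port: at most half of the halves of `M` are at `p`, so less than half of those of `N`. -/
theorem exists_cons_of_bind_directions_eq {v a b : V} {M N : Multiset (Sym2 V)}
    (hM : T.φ (covMonomial M) ≠ 0)
    (h : M.bind (directions hG v) = a ::ₘ b ::ₘ N.bind (directions hG v))
    (hp : T.port v a ≠ some v) (hab : T.port v b = T.port v a) :
    ∃ c d N', N = s(c, d) ::ₘ N' ∧ OnPath hG v c d ∧
      T.port v (step hG v c) ≠ T.port v a ∧ T.port v (step hG v d) ≠ T.port v a := by
  classical
  by_contra! hcon
  have hle := two_mul_countP_port_le (hG := hG) hM hp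
  have hge := card_le_two_mul_countP_port (hG := hG) (v := v) (N := N) (p := T.port v a)
    fun c d hcd hv hc => by
      obtain ⟨N', rfl⟩ := Multiset.exists_cons_of_mem hcd
      exact hcon c d N' rfl hv hc
  rw [h, Multiset.countP_cons, Multiset.countP_cons, if_pos rfl, if_pos hab, Multiset.card_cons,
    Multiset.card_cons] at hle
  omega

end Joinable

/-! ### Rewriting monomials by tetrads -/

section Rewriting

variable [Fintype V]

/-- The class of a monomial modulo the linear forms and the tetrads. -/
noncomputable def residue (T : DAG V) (M : Multiset (Sym2 V)) :
    CovRing V ⧸ Ideal.span (T.linearForms ∪ T.tetrads) :=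
  Ideal.Quotient.mk _ (covMonomial M)

theorem residue_cons (i j : V) (M : Multiset (Sym2 V)) :
    T.residue (s(i, j) ::ₘ M) = Ideal.Quotient.mk _ (σ i j) * T.residue M := by
  rw [residue, covMonomial_cons, map_mul, residue]

theorem φ_covMonomial_eq_of_residue_eq (hG : T.skeleton.IsTree) {M N : Multiset (Sym2 V)}
    (h : T.residue M = T.residue N) : T.φ (covMonomial M) = T.φ (covMonomial N) := by
  have hmem := (span_le_ciIdeal hG).trans (ciIdeal_le_vanishingIdeal hG) (Ideal.Quotient.eq.1 h)
  rwa [vanishingIdeal, RingHom.mem_ker, map_sub, sub_eq_zero] at hmem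

theorem isChokePoint_of_joinable {v i j k l : V} (hij : Joinable hG v i j)
    (hkl : Joinable hG v k l) (hil : Joinable hG v i l) (hkj : Joinable hG v k j) :
    T.IsChokePoint v {i, k} {j, l} := by
  have onPath : ∀ a ∈ ({i, k} : Set V), ∀ b ∈ ({j, l} : Set V), OnPath hG v a b := by
    rintro a (rfl | rfl) b (rfl | rfl)
    exacts [hij.1, hil.1, hkj.1, hkl.1]
  rw [isChokePoint_iff hG]
  by_cases h : ¬ T.Adj (step hG v i) v ∧ ¬ T.Adj (step hG v k) v
  · refine .inl fun a ha b hb hab => ⟨onPath a ha b hb, hab.descends (onPath a ha b hb) ?_⟩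
    rcases ha with rfl | rfl
    exacts [h.1, h.2]
  · have hjl : ¬ T.Adj (step hG v j) v ∧ ¬ T.Adj (step hG v l) v := by
      have := hij.2
      have := hkl.2
      have := hil.2
      have := hkj.2
      tauto
    refine .inr fun b hb a ha hba =>
      ⟨(onPath a ha b hb).symm, hba.descends (onPath a ha b hb).symm ?_⟩
    rcases hb with rfl | rfl
    exacts [hjl.1, hjl.2]

theorem residue_exchange {v i j k l : V} (hij : Joinable hG v i j) (hkl : Joinable hG v k l)
    (hil : Joinable hG v i l) (hkj : Joinable hG v k j) (N : Multiset (Sym2 V)) :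
    T.residue (s(i, j) ::ₘ s(k, l) ::ₘ N) = T.residue (s(i, l) ::ₘ s(k, j) ::ₘ N) := by
  have htetrad : σ i j * σ k l - σ i l * σ k j ∈ T.tetrads := by
    rw [σ_comm k j]
    exact ⟨i, j, k, l, ⟨v, isChokePoint_of_joinable hij hkl hil hkj⟩, rfl⟩
  simp only [residue_cons]
  rw [← mul_assoc, ← mul_assoc, ← map_mul, ← map_mul,
    Ideal.Quotient.eq.2 (Ideal.subset_span (.inr htetrad))]

/-- The halves towards `k` and `l` cannot be interchanged directly because those towards `z` and `l`
might collide; a trek through `v` that avoids their common port mediates. -/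
theorem exists_residue_exchange_of_port_eq {v i k l z : V} {M N : Multiset (Sym2 V)}
    (hM : T.φ (covMonomial M) ≠ 0)
    (hMN : M.bind (directions hG v) = step hG v l ::ₘ step hG v z ::ₘ N.bind (directions hG v))
    (hN : ∀ c d, s(c, d) ∈ N → Linked hG c d)
    (hil : Joinable hG v i l) (hkz : Joinable hG v k z) (hik : Joinable hG v i k)
    (hl : T.port v (step hG v l) ≠ some v)
    (hzl : T.port v (step hG v z) = T.port v (step hG v l)) :
    ∃ N', T.residue (s(i, l) ::ₘ s(k, z) ::ₘ N) = T.residue (s(i, k) ::ₘ N') := by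
  obtain ⟨c, d, N', rfl, hcd, hc, hd⟩ := exists_cons_of_bind_directions_eq hM hMN hl hzl
  have hcd : Joinable hG v c d := (hN c d (Multiset.mem_cons_self _ _)).joinable hcd
  have exchange_via {c d : V} (hdc : Joinable hG v d c) (hic : Joinable hG v i c)
      (hc : T.port v (step hG v c) ≠ T.port v (step hG v l))
      (hd : T.port v (step hG v d) ≠ T.port v (step hG v l)) :
      T.residue (s(i, l) ::ₘ s(k, z) ::ₘ s(d, c) ::ₘ N') =
        T.residue (s(i, k) ::ₘ s(z, c) ::ₘ s(d, l) ::ₘ N') := by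
    have hdl : Joinable hG v d l := joinable_of_port_ne hd
    have hzc : Joinable hG v z c := joinable_of_port_ne fun heq => hc (heq.symm.trans hzl)
    rw [Multiset.cons_swap s(k, z), residue_exchange hil hdc hic hdl, Multiset.cons_swap s(d, l),
      Sym2.eq_swap (a := k), residue_exchange hic hkz.symm hik hzc]
  rcases hcd.joinable_or (i := i) with hic | hid
  · rw [Sym2.eq_swap (a := c)]
    exact ⟨_, exchange_via hcd.symm hic hc hd⟩
  · exact ⟨_, exchange_via hcd hid hd hc⟩

theorem exists_residue_exchange {v i j l : V} {M N : Multiset (Sym2 V)}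
    (hne : T.φ (covMonomial (s(i, j) ::ₘ M)) ≠ 0)
    (h : T.φ (covMonomial (s(i, j) ::ₘ M)) = T.φ (covMonomial (s(i, l) ::ₘ N)))
    (hj : OnPath hG v i j) (hl : OnPath hG v i l) :
    ∃ k N', OnPath hG v i k ∧ step hG v k = step hG v j ∧
      T.residue (s(i, l) ::ₘ N) = T.residue (s(i, k) ::ₘ N') := by
  by_cases hlj : step hG v l = step hG v j
  · exact ⟨l, N, hl, hlj, rfl⟩
  have linked_N {a b : V} (hab : s(a, b) ∈ s(i, l) ::ₘ N) : Linked hG a b :=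
    linked_of_mem (h ▸ hne) hab
  have hil := (linked_N (Multiset.mem_cons_self _ _)).joinable hl
  have hbind : step hG v j ::ₘ M.bind (directions hG v) =
      step hG v l ::ₘ N.bind (directions hG v) := by
    have := bind_directions_eq hG hne h v
    rwa [Multiset.cons_bind, Multiset.cons_bind, hj.directions_eq, hl.directions_eq,
      Multiset.insert_eq_cons, Multiset.insert_eq_cons, Multiset.cons_add, Multiset.cons_add,
      Multiset.cons_inj_right, Multiset.singleton_add, Multiset.singleton_add] at this
  have hmem : step hG v j ∈ N.bind (directions hG v) :=
    (Multiset.mem_cons.1 (hbind ▸ Multiset.mem_cons_self _ _)).resolve_left (Ne.symm hlj)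
  obtain ⟨k, z, N, rfl, hkz, hk⟩ := exists_cons_of_mem_bind_directions hmem
  have hik : Joinable hG v i k :=
    ((linked_of_mem hne (Multiset.mem_cons_self _ _)).joinable hj).congr_right hk
  have hkz' : Joinable hG v k z :=
    (linked_N (Multiset.mem_cons_of_mem (Multiset.mem_cons_self _ _))).joinable hkz
  have hM : T.φ (covMonomial M) ≠ 0 := by
    rw [covMonomial_cons, map_mul] at hne
    exact right_ne_zero_of_mul hne
  suffices ∃ N', T.residue (s(i, l) ::ₘ s(k, z) ::ₘ N) = T.residue (s(i, k) ::ₘ N') by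
    obtain ⟨N', hN'⟩ := this
    exact ⟨k, N', hik.1, hk, hN'⟩
  by_cases hzl : Joinable hG v z l
  · refine ⟨s(z, l) ::ₘ N, ?_⟩
    rw [Sym2.eq_swap (a := k)]
    exact residue_exchange hil hkz'.symm hik hzl N
  rw [joinable_iff, Classical.not_imp] at hzl
  refine exists_residue_exchange_of_port_eq hM ?_ (fun c d hcd => linked_N ?_) hil hkz' hik
    (hzl.1 ▸ hzl.2) hzl.1
  · rw [Multiset.cons_bind, hkz.directions_eq, hk, Multiset.insert_eq_cons, Multiset.cons_add,
      Multiset.singleton_add, Multiset.cons_swap, Multiset.cons_inj_right] at hbind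
    exact hbind
  · exact Multiset.mem_cons_of_mem (Multiset.mem_cons_of_mem hcd)

theorem exists_residue_eq_cons (hG : T.skeleton.IsTree) {i j : V} {M N : Multiset (Sym2 V)}
    (hne : T.φ (covMonomial (s(i, j) ::ₘ M)) ≠ 0)
    (h : T.φ (covMonomial (s(i, j) ::ₘ M)) = T.φ (covMonomial N)) :
    ∃ N', T.residue N = T.residue (s(i, j) ::ₘ N') := by
  have along_path (v : V) : ∀ l N, OnPath hG v i j → OnPath hG v i l →
      T.φ (covMonomial (s(i, j) ::ₘ M)) = T.φ (covMonomial (s(i, l) ::ₘ N)) →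
      ∃ N', T.residue (s(i, l) ::ₘ N) = T.residue (s(i, j) ::ₘ N') := by
    induction v using induction_toward hG j with
    | base =>
      intro l N hj hl h
      obtain ⟨k, N', -, hkj, hN'⟩ := exists_residue_exchange hne h hj hl
      rw [step_self, step_eq_self_iff] at hkj
      exact ⟨N', hkj ▸ hN'⟩
    | next v _ ih =>
      intro l N hj hl h
      obtain ⟨k, N', hk, hkj, hN'⟩ := exists_residue_exchange hne h hj hl
      rw [hN']
      exact ih k N' ((onPath_step hG v j).trans_right hj)
        (hkj ▸ (onPath_step hG v k).trans_right hk)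
        (h.trans (φ_covMonomial_eq_of_residue_eq hG hN'))
  have hi : i ∈ N.bind (directions hG i) := by
    rw [← bind_directions_eq hG hne h i, Multiset.cons_bind, (onPath_left hG i j).directions_eq,
      step_self]
    exact Multiset.mem_add.2 (.inl (Multiset.mem_cons_self _ _))
  obtain ⟨k, l, N, rfl, -, hk⟩ := exists_cons_of_mem_bind_directions hi
  obtain rfl := (step_eq_self_iff hG).1 hk
  exact along_path i l N (onPath_left hG i j) (onPath_left hG i l) h

theorem residue_eq_of_φ_covMonomial_eq (hG : T.skeleton.IsTree) {M N : Multiset (Sym2 V)}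
    (hne : T.φ (covMonomial M) ≠ 0) (h : T.φ (covMonomial M) = T.φ (covMonomial N)) :
    T.residue M = T.residue N := by
  induction M using Multiset.induction generalizing N with
  | empty =>
    induction N using Multiset.induction with
    | empty => rfl
    | cons s N _ =>
      induction s with | h i j =>
      have hi := bind_directions_eq hG hne h i
      rw [Multiset.cons_bind, (onPath_left hG i j).directions_eq, Multiset.insert_eq_cons,
        Multiset.cons_add] at hi
      exact absurd hi.symm (Multiset.cons_ne_zero)
  | cons s M ih =>
    induction s with | h i j =>
    obtain ⟨N', hN'⟩ := exists_residue_eq_cons hG hne h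
    have hMN' := h.trans (φ_covMonomial_eq_of_residue_eq hG hN')
    rw [covMonomial_cons, map_mul] at hne
    rw [covMonomial_cons, covMonomial_cons, map_mul, map_mul] at hMN'
    rw [hN', residue_cons, residue_cons,
      ih (right_ne_zero_of_mul hne) (mul_left_cancel₀ (left_ne_zero_of_mul hne) hMN')]

/-! ### The vanishing ideal -/

theorem Linked.exists_trekPolynomial_eq {i j : V} (h : Linked hG i j) :
    ∃ s : Multiset (V ⊕ T.Edge), T.trekPolynomial i j = (s.map MvPolynomial.X).prod := by
  classical
  obtain ⟨t, ht⟩ := h.exists_isTopOf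
  refine ⟨.inl t ::ₘ (Finset.univ.filter
    fun e : T.Edge => s(e.1.1, e.1.2) ∈ (path hG i j).edges).val.map .inr, ?_⟩
  rw [ht.trekPolynomial_eq, weight, Finset.prod, Multiset.map_cons, Multiset.prod_cons,
    Multiset.map_map]
  rfl

theorem exists_φ_covMonomial_eq {M : Multiset (Sym2 V)}
    (hM : ∀ i j, s(i, j) ∈ M → Linked hG i j) :
    ∃ s : Multiset (V ⊕ T.Edge), T.φ (covMonomial M) = (s.map MvPolynomial.X).prod := by
  induction M using Multiset.induction with
  | empty => exact ⟨0, by simp [covMonomial]⟩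
  | cons p M ih =>
    induction p with | h i j =>
    obtain ⟨s, hs⟩ := (hM i j (Multiset.mem_cons_self _ _)).exists_trekPolynomial_eq
    obtain ⟨t, ht⟩ := ih fun k l hkl => hM k l (Multiset.mem_cons_of_mem hkl)
    refine ⟨s + t, ?_⟩
    rw [covMonomial_cons, map_mul, φ_σ, hs, ht, Multiset.map_add, Multiset.prod_add]

theorem covMonomial_mem_span {M : Multiset (Sym2 V)} {i j : V} (hij : s(i, j) ∈ M)
    (h : ¬ Linked hG i j) : covMonomial M ∈ Ideal.span (T.linearForms ∪ T.tetrads) := by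
  obtain ⟨M', rfl⟩ := Multiset.exists_cons_of_mem hij
  rw [← nonempty_trek_iff, not_nonempty_iff] at h
  rw [covMonomial_cons]
  exact Ideal.mul_mem_right _ _ (Ideal.subset_span (.inl ⟨i, j, h, rfl⟩))

theorem covMonomial_mem_span_of_φ_eq_zero (hG : T.skeleton.IsTree) {M : Multiset (Sym2 V)}
    (h : T.φ (covMonomial M) = 0) : covMonomial M ∈ Ideal.span (T.linearForms ∪ T.tetrads) := by
  classical
  by_contra hM
  obtain ⟨s, hs⟩ := exists_φ_covMonomial_eq (T := T) (hG := hG) (M := M) fun i j hij =>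
    not_imp_comm.1 (covMonomial_mem_span hij) hM
  rw [hs, prod_map_X_eq_monomial, MvPolynomial.monomial_eq_zero] at h
  exact one_ne_zero h

theorem vanishingIdeal_le_span (hG : T.skeleton.IsTree) :
    T.vanishingIdeal ≤ Ideal.span (T.linearForms ∪ T.tetrads) := by
  classical
  have basis_eq (m : Sym2 V →₀ ℕ) :
      MvPolynomial.basisMonomials (Sym2 V) ℂ m = covMonomial (Finsupp.toMultiset m) := by
    rw [MvPolynomial.coe_basisMonomials, covMonomial, prod_map_X_eq_monomial,
      Finsupp.toMultiset_toFinsupp]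
  refine ker_le_of_forall_basis (MvPolynomial.basisMonomials (Sym2 V) ℂ)
    (MvPolynomial.basisMonomials (V ⊕ T.Edge) ℂ) T.φ.toLinearMap
    ((Ideal.span (T.linearForms ∪ T.tetrads)).restrictScalars ℂ) ?_ ?_ ?_
  all_goals
    simp only [basis_eq, AlgHom.toLinearMap_apply, Submodule.restrictScalars_mem]
  · intro m
    refine or_iff_not_imp_left.2 fun hne => ?_
    obtain ⟨s, hs⟩ := exists_φ_covMonomial_eq fun i j => linked_of_mem (hG := hG) hne
    exact ⟨s.toFinsupp, by rw [hs, prod_map_X_eq_monomial, MvPolynomial.coe_basisMonomials]⟩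
  · exact fun m => covMonomial_mem_span_of_φ_eq_zero hG
  · exact fun m n h hne => Ideal.Quotient.eq.1 (residue_eq_of_φ_covMonomial_eq hG hne h)

end Rewriting

end DAG

theorem mainTheorem1 {V : Type*} [Fintype V] (T : DAG V) (hT : T.IsPolytree) :
    T.vanishingIdeal = T.ciIdeal ∧
      T.vanishingIdeal = Ideal.span (T.linearForms ∪ T.tetrads) := by
  have vanishing_le_span := DAG.vanishingIdeal_le_span hT
  have span_le_ci := DAG.span_le_ciIdeal hT
  have ci_le_vanishing := DAG.ciIdeal_le_vanishingIdeal hT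
  exact ⟨le_antisymm (vanishing_le_span.trans span_le_ci) ci_le_vanishing,
    le_antisymm vanishing_le_span (span_le_ci.trans ci_le_vanishing)⟩
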